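/- **Setting.** Let $\mathcal K$ be a simplicial complex on a vertex set $V$ (a family of finite nonempty subsets of $V$ that contains all singletons and all nonempty subsets of its members), of dimension at most $N<\infty$ and such that every $n$-simplex is contained in at most $L<\infty$ simplices of dimension $n+1$. Let $\mathcal K_n$ be the set of its $n$-simplices, choose an orientation of every simplex, and let $\epsilon_{z,x}\in\{0,\pm1\}$ be the resulting incidence numbers. Let $\mathcal C_n$ be the free abelian group on $\mathcal K_n$, with $\partial x=\sum_y\epsilon_{x,y}\,y$ and $\hat\partial x=\sum_z\epsilon_{z,x}\,z$. Let $(\mathbb G_\bullet,\partial^{\mathbb G}_\bullet)$ be a chain complex of finite abelian groups with $\mathbb G_j=0$ for $j<0$ and $j>N$, let $\widehat{\mathbb G}_j$ be the group of characters $\mathbb G_j\to U(1)$, written additively, and set $\hat\partial^{\mathbb G}_{j+1}(\alpha)=\alpha\circ\partial^{\mathbb G}_{j+1}$ for $\alpha\in\widehat{\mathbb G}_j$. A $p$-map is a family of homomorphisms $t_n:\mathcal C_n\to\mathbb G_{n-p}$, and a dual $p$-map is a family of homomorphisms $\gamma_n:\mathcal C_n\to\widehat{\mathbb G}_{n-p}$.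 Write $\mathrm{Hom}_0^p$ and $\mathrm{Hom}_{0,p}$ for the groups of those that are nonzero on only finitely many simplices. Put $$(\delta^pt)_n=t_{n-1}\circ\partial_n-(-1)^p\,\partial^{\mathbb G}_{n-p}\circ t_n,\qquad (\delta_p\gamma)_n=\gamma_{n+1}\circ\hat\partial_{n+1}-(-1)^{p-1}\,\hat\partial^{\mathbb G}_{n+1-p}\circ\gamma_n ,$$ and $\gamma(t)=\prod_x\gamma(x)[t(x)]\in U(1)$; with these signs, $\gamma(\delta^pt)=(\delta_{p+1}\gamma)(t)$. For $x\in\mathcal K_n$ let $\mathfrak h_x=\ell^2(\mathbb G_n)$. Let $\mathfrak A$ be the quasi-local $C^*$-algebra: the norm closure of $\mathfrak A_{\rm loc}=\bigcup_\Lambda\mathcal B(\bigotimes_{x\in\Lambda}\mathfrak h_x)$, where $\Lambda$ runs over the finite sets of simplices. For $t\in\mathrm{Hom}_0^0$ and $\gamma\in\mathrm{Hom}_{0,0}$ let $P_t,Q_\gamma\in\mathfrak A_{\rm loc}$ be the unitaries $P_t|c\rangle=|t+c\rangle$ and $Q_\gamma|c\rangle=\gamma(c)|c\rangle$; the products $P_tQ_\gamma$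 are called Weyl monomials. Set $A_t=P_{\delta^{-1}t}$ for $t\in\mathrm{Hom}_0^{-1}$ and $B_\gamma=Q_{\delta_1\gamma}$ for $\gamma\in\mathrm{Hom}_{0,1}$. For $x\in\mathcal K_n$ let $x^*_g$ (respectively $x_*^\alpha$) be the map with value $g$ (respectively $\alpha$) at $x$ and $0$ at all other simplices, and put $$A^0_x=\frac1{|\mathbb G_{n+1}|}\sum_{g\in\mathbb G_{n+1}}A_{x^*_g},\qquad B^0_x=\frac1{|\mathbb G_{n-1}|}\sum_{\alpha\in\widehat{\mathbb G}_{n-1}}B_{x_*^\alpha}.$$ Put $\mathrm{supp}(A^0_x)=\{x\}\cup\{z:\epsilon_{z,x}\ne0\}$ and $\mathrm{supp}(B^0_x)=\{x\}\cup\{y:\epsilon_{x,y}\ne0\}$, and let $$H^\Lambda=-\sum_{\mathrm{supp}(A_x^0)\subseteq\Lambda}A^0_x-\sum_{\mathrm{supp}(B_x^0)\subseteq\Lambda}B^0_x .$$ For $a\in\mathfrak A_{\rm loc}$ let $\delta(a)=i[H^\Lambda,a]$ for all sufficiently large finite $\Lambda$. A state is a positive linear functional with value $1$ at the unit. Let $\mathrm{FG}_{\rm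 QDM}(\mathfrak A)$ be the set of frustration-free ground states, that is, of the states $\omega$ on $\mathfrak A$ with $-i\,\omega(a^*\delta(a))\ge0$ for all $a\in\mathfrak A_{\rm loc}$ and $\omega(A^0_x)=\omega(B^0_x)=1$ for all simplices $x$. Let $\mathfrak K\subseteq\mathfrak A$ be the $C^*$-subalgebra generated by all $A_t$ and $B_\gamma$, and let $\mathfrak K'$ be its commutant in $\mathfrak A$. **Statement.** One has $\mathfrak K\subseteq\mathfrak K'$, and there is exactly one state $\vartheta$ on $\mathfrak K$ (the seed state) with $\vartheta(A_tB_\gamma)=1$ for all $t\in\mathrm{Hom}_0^{-1}$ and $\gamma\in\mathrm{Hom}_{0,1}$. Let $S_\vartheta(\mathfrak K')$ be the set of states $\tau$ on $\mathfrak K'$ with $\tau|_{\mathfrak K}=\vartheta$. Then restriction $\omega\mapsto\omega|_{\mathfrak K'}$ is a bijection from $\mathrm{FG}_{\rm QDM}(\mathfrak A)$ onto $S_\vartheta(\mathfrak K')$. Moreover, every $\tau\in S_\vartheta(\mathfrak K')$ has exactly one extension to a state $\omega$ on $\mathfrak A$. This $\omega$ belongs to $\mathrm{FG}_{\rm QDM}(\mathfrak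 A)$, and for all $t\in\mathrm{Hom}_0^0$ and $\gamma\in\mathrm{Hom}_{0,0}$ $$\omega(P_tQ_\gamma)=\begin{cases}\tau(P_tQ_\gamma)&\text{if }P_tQ_\gamma\in\mathfrak K',\\0&\text{if }P_tQ_\gamma\notin\mathfrak K'.\end{cases}$$ -/

import Mathlib

open scoped ComplexOrder

noncomputable section

namespace HAQDM

universe u v

/-! ### Geometric data -/

/-- An oriented simplicial complex on the vertex set `V`, of dimension at most `N` and `L`-regular.
The linear order on `V` is only a reference: it orients every simplex, and `orient s = ± 1` says
whether the chosen orientation of `s` agrees with that one.  As a simplex of positive dimension has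
exactly two orientations and a vertex has exactly one, every choice of orientations of the simplices
is obtained in this way. -/
structure GeometricData (V : Type u) [LinearOrder V] (N L : ℕ) where
  complex : AbstractSimplicialComplex V
  card_le : ∀ s ∈ complex.faces, s.card ≤ N + 1
  regular : ∀ s ∈ complex.faces,
    {z | z ∈ complex.faces ∧ s ⊆ z ∧ z.card = s.card + 1}.encard ≤ L
  orient : complex.faces → ℤˣ
  orient_vertex : ∀ s : complex.faces, s.1.card = 1 → orient s = 1

/-! ### Algebraic data -/

/-- A chain complex of finite abelian groups with `grp j = 0` for `j < 0` and for `j > N`.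
`d j` is the boundary map `∂_{j+1} : 𝔾_{j+1} → 𝔾_j`. -/
structure AlgebraicData (N : ℕ) where
  grp : ℤ → Type v
  [addCommGroup : ∀ j, AddCommGroup (grp j)]
  [finite : ∀ j, Finite (grp j)]
  d : ∀ j, grp (j + 1) →+ grp j
  d_comp_d : ∀ j g, d j (d (j + 1) g) = 0
  trivial : ∀ j, (j < 0 ∨ (N : ℤ) < j) → Subsingleton (grp j)

attribute [instance] AlgebraicData.addCommGroup AlgebraicData.finite

variable {V : Type u} [LinearOrder V] {N L : ℕ}

/-- The set `𝔎_n` of `n`-simplices (empty for `n < 0`). -/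
def Simplex (X : GeometricData V N L) (n : ℤ) : Type u :=
  {s : Finset V // s ∈ X.complex.faces ∧ (s.card : ℤ) = n + 1}

/-- The set of all simplices, sorted by dimension. -/
abbrev Site (X : GeometricData V N L) : Type u := Σ n : ℤ, Simplex X n

/-- The incidence number `ε_{z,x}`: if `z` has vertices `v_0 < ⋯ < v_k` and `x = z ∖ {v_i}`, it is
`(-1)^i` corrected by the orientation signs of `z` and `x`; it is `0` if `x` is not a face of
codimension one of `z`. -/
def incidence (X : GeometricData V N L) {m n : ℤ} (z : Simplex X m) (x : Simplex X n) : ℤ :=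
  ∑ v ∈ z.1, if z.1.erase v = x.1 then
    (X.orient ⟨z.1, z.2.1⟩ : ℤ) * (X.orient ⟨x.1, x.2.1⟩ : ℤ) *
      (-1) ^ (z.1.filter (fun w => w < v)).card
  else 0

theorem exists_of_incidence_ne_zero (X : GeometricData V N L) {m n : ℤ} {z : Simplex X m}
    {x : Simplex X n} (h : incidence X z x ≠ 0) : ∃ v ∈ z.1, z.1.erase v = x.1 := by
  obtain ⟨v, hv, h'⟩ := Finset.exists_ne_zero_of_sum_ne_zero h
  exact ⟨v, hv, by by_contra hc; simp [hc] at h'⟩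

theorem site_ext {X : GeometricData V N L} {s s' : Site X} (h : s.2.1 = s'.2.1) : s = s' := by
  obtain ⟨n, x, hx⟩ := s
  obtain ⟨m, y, hy⟩ := s'
  obtain rfl : x = y := h
  obtain rfl : n = m := by have := hx.2; have := hy.2; omega
  rfl

theorem finite_faces (X : GeometricData V N L) (x : Site X) :
    {y : Site X | incidence X x.2 y.2 ≠ 0}.Finite := by
  refine Set.Finite.of_finite_image (f := fun y : Site X => y.2.1) ?_
    (fun y _ y' _ h => site_ext h)
  refine ((x.2.1.image (fun v => x.2.1.erase v)).finite_toSet).subset ?_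
  rintro _ ⟨y, hy, rfl⟩
  obtain ⟨v, hv, h⟩ := exists_of_incidence_ne_zero X hy
  simp only [Finset.coe_image, Set.mem_image]
  exact ⟨v, hv, h⟩

theorem finite_cofaces (X : GeometricData V N L) (x : Site X) :
    {z : Site X | incidence X z.2 x.2 ≠ 0}.Finite := by
  refine Set.Finite.of_finite_image (f := fun y : Site X => y.2.1) ?_
    (fun y _ y' _ h => site_ext h)
  have hfin : {z | z ∈ X.complex.faces ∧ x.2.1 ⊆ z ∧ z.card = x.2.1.card + 1}.Finite :=
    Set.finite_of_encard_le_coe (X.regular x.2.1 x.2.2.1)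
  refine hfin.subset ?_
  rintro _ ⟨z, hz, rfl⟩
  obtain ⟨v, hv, h⟩ := exists_of_incidence_ne_zero X hz
  refine ⟨z.2.2.1, ?_, ?_⟩
  · rw [← h]; exact Finset.erase_subset _ _
  · rw [← h, Finset.card_erase_add_one hv]

/-- The group `𝔠_n` of simplicial `n`-chains: the free abelian group on `𝔎_n`. -/
abbrev Chain (X : GeometricData V N L) (n : ℤ) : Type u := Simplex X n →₀ ℤ

/-- The morphism from `n`-chains with prescribed values on the basis. -/
def liftChain (X : GeometricData V N L) {n : ℤ} {A : Type*} [AddCommGroup A]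
    (f : Simplex X n → A) : Chain X n →+ A :=
  (Finsupp.linearCombination ℤ f).toAddMonoidHom

theorem sigma_finite {X : GeometricData V N L} {n : ℤ} {S : Set (Site X)} (h : S.Finite) :
    {y : Simplex X n | (⟨n, y⟩ : Site X) ∈ S}.Finite :=
  h.preimage (sigma_mk_injective.injOn)

/-- The boundary operator `x ↦ ∑_y ε_{x,y} y`, from `n`-chains to `m`-chains, used for
`m = n - 1`. -/
def boundary (X : GeometricData V N L) (n m : ℤ) : Chain X n →+ Chain X m :=
  liftChain X fun x => Finsupp.ofSupportFinite (fun y => incidence X x y)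
    (sigma_finite (finite_faces X ⟨n, x⟩))

/-- The coboundary operator `x ↦ ∑_z ε_{z,x} z`, from `n`-chains to `m`-chains, used for
`m = n + 1`. -/
def coboundary (X : GeometricData V N L) (n m : ℤ) : Chain X n →+ Chain X m :=
  liftChain X fun x => Finsupp.ofSupportFinite (fun z => incidence X z x)
    (sigma_finite (finite_cofaces X ⟨n, x⟩))

/-! ### Characters -/

/-- The Pontryagin dual of `𝔾_j`, written additively. -/
abbrev AlgebraicData.dual (G : AlgebraicData.{v} N) (j : ℤ) : Type v := AddChar (G.grp j) Circle

/-- The identity `𝔾_i → 𝔾_j` for `i = j`. -/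
def AlgebraicData.cast (G : AlgebraicData.{v} N) {i j : ℤ} (h : i = j) : G.grp i →+ G.grp j :=
  h ▸ AddMonoidHom.id (G.grp i)

/-- The identity between the duals of `𝔾_i` and `𝔾_j` for `i = j`. -/
def AlgebraicData.dualCast (G : AlgebraicData.{v} N) {i j : ℤ} (h : i = j) :
    G.dual i →+ G.dual j :=
  h ▸ AddMonoidHom.id (G.dual i)

/-- The adjoint `α ↦ α ∘ ∂_{j+1}` of the boundary map `∂_{j+1}`. -/
def AlgebraicData.dualD (G : AlgebraicData.{v} N) (j : ℤ) : G.dual j →+ G.dual (j + 1) where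
  toFun α := α.compAddMonoidHom (G.d j)
  map_zero' := by ext; simp
  map_add' α β := by ext; simp

/-! ### `p`-maps -/

/-- The group of `p`-maps: families of morphisms `t_n : 𝔠_n → 𝔾_{n-p}`. -/
abbrev PMap (X : GeometricData V N L) (G : AlgebraicData.{v} N) (p : ℤ) : Type (max u v) :=
  ∀ n : ℤ, Chain X n →+ G.grp (n - p)

/-- The group of dual `p`-maps: families of morphisms from `𝔠_n` to the dual of `𝔾_{n-p}`. -/
abbrev DualPMap (X : GeometricData V N L) (G : AlgebraicData.{v} N) (p : ℤ) : Type (max u v) :=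
  ∀ n : ℤ, Chain X n →+ G.dual (n - p)

/-- The value of a graded family of morphisms at a simplex. -/
def val {X : GeometricData V N L} {A : ℤ → Type*} [∀ n, AddCommGroup (A n)]
    (t : ∀ n, Chain X n →+ A n) (x : Site X) : A x.1 :=
  t x.1 (Finsupp.single x.2 1)

/-- The graded family of morphisms with prescribed values at the simplices. -/
def ofVal {X : GeometricData V N L} {A : ℤ → Type*} [∀ n, AddCommGroup (A n)]
    (f : ∀ x : Site X, A x.1) : ∀ n, Chain X n →+ A n :=
  fun n => liftChain X (fun x : Simplex X n => f ⟨n, x⟩)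

theorem val_ofVal {X : GeometricData V N L} {A : ℤ → Type*} [∀ n, AddCommGroup (A n)]
    (f : ∀ x : Site X, A x.1) (x : Site X) : val (ofVal f) x = f x := by
  simp [val, ofVal, liftChain]

/-- The subgroup of compactly supported families. -/
def compactlySupported (X : GeometricData V N L) (A : ℤ → Type*) [∀ n, AddCommGroup (A n)] :
    AddSubgroup (∀ n, Chain X n →+ A n) where
  carrier := {t | {x : Site X | val t x ≠ 0}.Finite}
  zero_mem' := by simp [val]
  add_mem' {a b} ha hb := by
    refine (Set.Finite.union ha hb).subset fun x hx => ?_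
    by_contra hc
    simp only [Set.mem_union, Set.mem_ofPred_eq, not_or, not_not] at hc
    exact hx (by have h1 := hc.1; have h2 := hc.2; simp only [val] at h1 h2 ⊢; simp [h1, h2])
  neg_mem' {a} ha := by
    refine Set.Finite.subset ha fun x hx => ?_
    simpa [val] using hx

/-- Compactly supported `p`-maps. -/
abbrev PMap₀ (X : GeometricData V N L) (G : AlgebraicData.{v} N) (p : ℤ) :
    AddSubgroup (PMap X G p) :=
  compactlySupported X fun n => G.grp (n - p)

/-- Compactly supported dual `p`-maps. -/
abbrev DualPMap₀ (X : GeometricData V N L) (G : AlgebraicData.{v} N) (p : ℤ) :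
    AddSubgroup (DualPMap X G p) :=
  compactlySupported X fun n => G.dual (n - p)

/-- `(δ^p t)_n = t_{n-1} ∘ ∂_n - (-1)^p ∂_{n-p} ∘ t_n`, where `q = p + 1`. -/
def delta (X : GeometricData V N L) (G : AlgebraicData.{v} N) {p q : ℤ} (h : p + 1 = q)
    (t : PMap X G p) : PMap X G q := fun n =>
  (G.cast (by omega : n - 1 - p = n - q)).comp ((t (n - 1)).comp (boundary X n (n - 1))) -
    (p.negOnePow : ℤ) •
      ((G.d (n - q)).comp (G.cast (by omega : n - p = n - q + 1))).comp (t n)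

/-- `(δ_p γ)_n = γ_{n+1} ∘ ∂̂_{n+1} - (-1)^{p-1} ∂̂_{n+1-p} ∘ γ_n`, where `p = q + 1`.
The sign is the one for which `δ_{q+1}` is the transpose of `δ^q`. -/
def dualDelta (X : GeometricData V N L) (G : AlgebraicData.{v} N) {p q : ℤ} (h : q + 1 = p)
    (γ : DualPMap X G p) : DualPMap X G q := fun n =>
  (G.dualCast (by omega : n + 1 - p = n - q)).comp ((γ (n + 1)).comp (coboundary X n (n + 1))) -
    (q.negOnePow : ℤ) •
      ((G.dualCast (by omega : n - p + 1 = n - q)).comp (G.dualD (n - p))).comp (γ n)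

theorem eq_zero_of_val {X : GeometricData V N L} {A : Type*} [AddCommGroup A] {n : ℤ}
    (f : Chain X n →+ A) (c : Chain X n) (h : ∀ y, c y ≠ 0 → f (Finsupp.single y 1) = 0) :
    f c = 0 := by
  classical
  rw [← Finsupp.sum_single c, Finsupp.sum, map_sum]
  refine Finset.sum_eq_zero fun y hy => ?_
  have h1 : Finsupp.single y (c y) = (c y) • Finsupp.single y (1 : ℤ) := by simp
  rw [h1, map_zsmul, h y (Finsupp.mem_support_iff.mp hy), smul_zero]

theorem boundary_single_apply (X : GeometricData V N L) {n m : ℤ} (x : Simplex X n)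
    (y : Simplex X m) : boundary X n m (Finsupp.single x 1) y = incidence X x y := by
  simp only [boundary, liftChain, LinearMap.toAddMonoidHom_coe, Finsupp.linearCombination_single,
    one_smul]
  rfl

theorem coboundary_single_apply (X : GeometricData V N L) {n m : ℤ} (x : Simplex X n)
    (z : Simplex X m) : coboundary X n m (Finsupp.single x 1) z = incidence X z x := by
  simp only [coboundary, liftChain, LinearMap.toAddMonoidHom_coe,
    Finsupp.linearCombination_single, one_smul]
  rfl

theorem delta_mem (X : GeometricData V N L) (G : AlgebraicData.{v} N) {p q : ℤ} (h : p + 1 = q)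
    (t : PMap X G p) (ht : t ∈ PMap₀ X G p) : delta X G h t ∈ PMap₀ X G q := by
  have hf : ({x : Site X | val t x ≠ 0} ∪
      ⋃ y ∈ {x : Site X | val t x ≠ 0}, {z : Site X | incidence X z.2 y.2 ≠ 0}).Finite :=
    Set.Finite.union ht (Set.Finite.biUnion ht fun y _ => finite_cofaces X y)
  refine hf.subset fun x hx => ?_
  by_contra hc
  simp only [Set.mem_union, Set.mem_iUnion, Set.mem_ofPred_eq, not_or, not_not, not_exists] at hc
  refine hx ?_
  have h1 : t x.1 (Finsupp.single x.2 1) = 0 := hc.1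
  have h2 : t (x.1 - 1) (boundary X x.1 (x.1 - 1) (Finsupp.single x.2 1)) = 0 := by
    refine eq_zero_of_val _ _ fun y hy => ?_
    rw [boundary_single_apply] at hy
    by_contra h3
    exact hy (hc.2 ⟨x.1 - 1, y⟩ h3)
  simp [val, delta, h1, h2]

theorem dualDelta_mem (X : GeometricData V N L) (G : AlgebraicData.{v} N) {p q : ℤ}
    (h : q + 1 = p) (γ : DualPMap X G p) (hγ : γ ∈ DualPMap₀ X G p) :
    dualDelta X G h γ ∈ DualPMap₀ X G q := by
  have hf : ({x : Site X | val γ x ≠ 0} ∪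
      ⋃ y ∈ {x : Site X | val γ x ≠ 0}, {z : Site X | incidence X y.2 z.2 ≠ 0}).Finite :=
    Set.Finite.union hγ (Set.Finite.biUnion hγ fun y _ => finite_faces X y)
  refine hf.subset fun x hx => ?_
  by_contra hc
  simp only [Set.mem_union, Set.mem_iUnion, Set.mem_ofPred_eq, not_or, not_not, not_exists] at hc
  refine hx ?_
  have h1 : γ x.1 (Finsupp.single x.2 1) = 0 := hc.1
  have h2 : γ (x.1 + 1) (coboundary X x.1 (x.1 + 1) (Finsupp.single x.2 1)) = 0 := by
    refine eq_zero_of_val _ _ fun y hy => ?_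
    rw [coboundary_single_apply] at hy
    by_contra h3
    exact hy (hc.2 ⟨x.1 + 1, y⟩ h3)
  simp [val, dualDelta, h1, h2]
  exact zsmul_zero _

/-- The pairing `γ(t) = ∏_x γ(x)[t(x)]` of a dual `p`-map and a `p`-map (one of them compactly
supported). -/
def pairing {X : GeometricData V N L} {G : AlgebraicData.{v} N} {p : ℤ} (γ : DualPMap X G p)
    (t : PMap X G p) : Circle :=
  ∏ᶠ x : Site X, (val γ x) (val t x)

/-- The `p`-map `x^*_g`, equal to `g` at `x` and to `0` at the other simplices. -/
def localized (X : GeometricData V N L) (G : AlgebraicData.{v} N) {p : ℤ} (x : Site X)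
    (g : G.grp (x.1 - p)) : PMap₀ X G p := by
  classical
  exact ⟨ofVal (A := fun n => G.grp (n - p)) (Pi.single x g), by
    refine (Set.finite_singleton x).subset fun y hy => ?_
    by_contra hc
    exact hy (by rw [val_ofVal, Pi.single_eq_of_ne hc])⟩

/-- The dual `p`-map `x_*^α`, equal to `α` at `x` and trivial at the other simplices. -/
def dualLocalized (X : GeometricData V N L) (G : AlgebraicData.{v} N) {p : ℤ} (x : Site X)
    (α : G.dual (x.1 - p)) : DualPMap₀ X G p := by
  classical
  exact ⟨ofVal (A := fun n => G.dual (n - p)) (Pi.single x α), by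
    refine (Set.finite_singleton x).subset fun y hy => ?_
    by_contra hc
    exact hy (by rw [val_ofVal, Pi.single_eq_of_ne hc])⟩

/-! ### The quasi-local algebra

`𝔥_x = ℓ²(𝔾_n)` for an `n`-simplex `x`, so that `⨂_{x ∈ Λ} 𝔥_x` has the orthonormal basis of the
configurations on `Λ`.  The algebras `𝔄_Λ` of all operators on these spaces, with the inclusions
`A ↦ A ⊗ 1`, are realized together on the Hilbert space whose orthonormal basis consists of all
compactly supported configurations. -/

/-- Compactly supported configurations (`0`-maps). -/
abbrev Conf (X : GeometricData V N L) (G : AlgebraicData.{v} N) : Type (max u v) := PMap₀ X G 0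

/-- Compactly supported representations (dual `0`-maps). -/
abbrev Repr (X : GeometricData V N L) (G : AlgebraicData.{v} N) : Type (max u v) :=
  DualPMap₀ X G 0

/-- The Hilbert space with orthonormal basis the compactly supported configurations. -/
abbrev Hilb (X : GeometricData V N L) (G : AlgebraicData.{v} N) : Type (max u v) :=
  lp (fun _ : Conf X G => ℂ) 2

/-- The basis vector `|c⟩`. -/
def ket {X : GeometricData V N L} {G : AlgebraicData.{v} N} (c : Conf X G) : Hilb X G := by
  classical
  exact lp.single 2 c (1 : ℂ)

theorem orthonormal_ket (X : GeometricData V N L) (G : AlgebraicData.{v} N) :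
    Orthonormal ℂ (ket : Conf X G → Hilb X G) := by
  classical
  rw [orthonormal_iff_ite]
  intro c c'
  rw [ket, lp.inner_single_left, ket]
  by_cases h : c = c'
  · subst h; simp
  · simp [lp.single_apply, h]

/-- The operator `A ⊗ 1` on `Λ ∪ Λᶜ`: `T` does not change a configuration off `Λ`, and its matrix
elements do not depend on the part of the configurations off `Λ`. -/
def IsSupportedOn {X : GeometricData V N L} {G : AlgebraicData.{v} N} (Λ : Finset (Site X))
    (T : Hilb X G →L[ℂ] Hilb X G) : Prop :=
  (∀ c c' : Conf X G, (∃ x ∉ Λ, val c.1 x ≠ val c'.1 x) → inner ℂ (ket c) (T (ket c')) = 0) ∧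
  (∀ c c' s : Conf X G, (∀ x ∈ Λ, val s.1 x = 0) →
    inner ℂ (ket (c + s)) (T (ket (c' + s))) = inner ℂ (ket c) (T (ket c')))

/-- The quasi-local algebra `𝔄`: the norm closure of `⋃_Λ 𝔄_Λ`. -/
def quasiLocal (X : GeometricData V N L) (G : AlgebraicData.{v} N) :
    StarSubalgebra ℂ (Hilb X G →L[ℂ] Hilb X G) :=
  (StarAlgebra.adjoin ℂ {T | ∃ Λ : Finset (Site X), IsSupportedOn Λ T}).topologicalClosure

/-- `𝔄` as a type. -/
abbrev QL (X : GeometricData V N L) (G : AlgebraicData.{v} N) : Type (max u v) := quasiLocal X G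

/-- The local observables `𝔄_loc`. -/
def localObservables (X : GeometricData V N L) (G : AlgebraicData.{v} N) : Set (QL X G) :=
  {a | ∃ Λ : Finset (Site X), IsSupportedOn Λ a.1}

theorem mem_quasiLocal {X : GeometricData V N L} {G : AlgebraicData.{v} N} (Λ : Finset (Site X))
    {T : Hilb X G →L[ℂ] Hilb X G} (h : IsSupportedOn Λ T) : T ∈ quasiLocal X G :=
  StarSubalgebra.le_topologicalClosure _ (StarAlgebra.subset_adjoin ℂ _ ⟨Λ, h⟩)

/-! ### Shift and clock operators -/

theorem orthonormal_shift {X : GeometricData V N L} {G : AlgebraicData.{v} N} (t : Conf X G) :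
    Orthonormal ℂ (fun c : Conf X G => ket (t + c)) :=
  (orthonormal_ket X G).comp (fun c => t + c) (add_right_injective t)

theorem orthonormal_clock {X : GeometricData V N L} {G : AlgebraicData.{v} N} (γ : Repr X G) :
    Orthonormal ℂ (fun c : Conf X G => (pairing γ.1 c.1 : ℂ) • ket c) := by
  classical
  have h := orthonormal_ket X G
  rw [orthonormal_iff_ite] at h ⊢
  intro c c'
  rw [inner_smul_left, inner_smul_right, h]
  by_cases hc : c = c'
  · subst hc
    simp [Complex.conj_mul', Circle.norm_coe]
  · simp [hc]

/-- The operator `P_t |c⟩ = |t + c⟩`. -/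
def shiftOp {X : GeometricData V N L} {G : AlgebraicData.{v} N} (t : Conf X G) :
    Hilb X G →L[ℂ] Hilb X G :=
  (orthonormal_shift t).orthogonalFamily.linearIsometry.toContinuousLinearMap

/-- The operator `Q_γ |c⟩ = γ(c) |c⟩`. -/
def clockOp {X : GeometricData V N L} {G : AlgebraicData.{v} N} (γ : Repr X G) :
    Hilb X G →L[ℂ] Hilb X G :=
  (orthonormal_clock γ).orthogonalFamily.linearIsometry.toContinuousLinearMap

theorem shiftOp_ket {X : GeometricData V N L} {G : AlgebraicData.{v} N} (t c : Conf X G) :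
    shiftOp t (ket c) = ket (t + c) := by
  classical
  simp [shiftOp, ket]

theorem clockOp_ket {X : GeometricData V N L} {G : AlgebraicData.{v} N} (γ : Repr X G)
    (c : Conf X G) : clockOp γ (ket c) = (pairing γ.1 c.1 : ℂ) • ket c := by
  classical
  simp [clockOp, ket]

theorem inner_ket {X : GeometricData V N L} {G : AlgebraicData.{v} N} (c c' : Conf X G)
    [Decidable (c = c')] : inner ℂ (ket c) (ket c') = if c = c' then (1 : ℂ) else 0 := by
  classical
  rw [orthonormal_iff_ite.mp (orthonormal_ket X G) c c']
  congr

theorem val_add {X : GeometricData V N L} {A : ℤ → Type*} [∀ n, AddCommGroup (A n)]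
    (s t : ∀ n, Chain X n →+ A n) (x : Site X) : val (s + t) x = val s x + val t x := rfl

theorem isSupportedOn_shiftOp {X : GeometricData V N L} {G : AlgebraicData.{v} N} (t : Conf X G) :
    IsSupportedOn (Set.Finite.toFinset (show {x : Site X | val t.1 x ≠ 0}.Finite from t.2))
      (shiftOp t) := by
  classical
  constructor
  · rintro c c' ⟨x, hx, hne⟩
    rw [shiftOp_ket, inner_ket, if_neg]
    rintro rfl
    simp only [Set.Finite.mem_toFinset, Set.mem_ofPred_eq, not_not] at hx
    exact hne (by rw [AddSubgroup.coe_add, val_add, hx, zero_add])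
  · intro c c' s _
    rw [shiftOp_ket, shiftOp_ket, inner_ket, inner_ket, ← add_assoc]
    simp

theorem isSupportedOn_clockOp {X : GeometricData V N L} {G : AlgebraicData.{v} N} (γ : Repr X G) :
    IsSupportedOn (Set.Finite.toFinset (show {x : Site X | val γ.1 x ≠ 0}.Finite from γ.2))
      (clockOp γ) := by
  classical
  constructor
  · rintro c c' ⟨x, hx, hne⟩
    rw [clockOp_ket, inner_smul_right, inner_ket, if_neg, mul_zero]
    rintro rfl
    exact hne rfl
  · intro c c' s hs
    rw [clockOp_ket, clockOp_ket, inner_smul_right, inner_smul_right, inner_ket, inner_ket]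
    have h : pairing γ.1 (c' + s).1 = pairing γ.1 c'.1 := by
      refine finprod_congr fun x => ?_
      by_cases hx : val γ.1 x = 0
      · simp [hx]
      · rw [AddSubgroup.coe_add, val_add, hs x (by simpa using hx), add_zero]
    rw [h]
    simp

/-- The shift operator `P_t` in `𝔄`. -/
def shift {X : GeometricData V N L} {G : AlgebraicData.{v} N} (t : Conf X G) : QL X G :=
  ⟨shiftOp t, mem_quasiLocal _ (isSupportedOn_shiftOp t)⟩

/-- The clock operator `Q_γ` in `𝔄`. -/
def clock {X : GeometricData V N L} {G : AlgebraicData.{v} N} (γ : Repr X G) : QL X G :=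
  ⟨clockOp γ, mem_quasiLocal _ (isSupportedOn_clockOp γ)⟩

/-- `A_t = P_{δ^{-1} t}` for a compactly supported `(-1)`-map `t`. -/
def gaugeA {X : GeometricData V N L} {G : AlgebraicData.{v} N} (t : PMap₀ X G (-1)) : QL X G :=
  shift ⟨delta X G (by norm_num : (-1 : ℤ) + 1 = 0) t.1, delta_mem X G _ t.1 t.2⟩

/-- `B_γ = Q_{δ_1 γ}` for a compactly supported dual `1`-map `γ`. -/
def gaugeB {X : GeometricData V N L} {G : AlgebraicData.{v} N} (γ : DualPMap₀ X G 1) : QL X G :=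
  clock ⟨dualDelta X G (by norm_num : (0 : ℤ) + 1 = 1) γ.1, dualDelta_mem X G _ γ.1 γ.2⟩

/-- The generalized star operator `A_x^0`, the average of `A_{x^*_g}` over the finite group
`𝔾_{n+1}`. -/
def starOp {X : GeometricData V N L} (G : AlgebraicData.{v} N) (x : Site X) : QL X G :=
  (Nat.card (G.grp (x.1 - (-1))) : ℂ)⁻¹ •
    ∑ᶠ g : G.grp (x.1 - (-1)), gaugeA (localized X G x g)

/-- The dual of a finite group is finite. -/
instance finite_dual (G : AlgebraicData.{v} N) (j : ℤ) : Finite (G.dual j) :=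
  Finite.of_injective _ (AddChar.circleEquivComplex (α := G.grp j)).injective

/-- The generalized plaquette operator `B_x^0`, the average of `B_{x_*^α}` over the (finite) dual
of `𝔾_{n-1}`. -/
def plaquetteOp {X : GeometricData V N L} (G : AlgebraicData.{v} N) (x : Site X) : QL X G :=
  (Nat.card (G.grp (x.1 - 1)) : ℂ)⁻¹ •
    ∑ᶠ α : G.dual (x.1 - 1), gaugeB (dualLocalized X G x α)

/-! ### Dynamics and ground states -/

/-- The support of `A_x^0`: `x` and its coboundary. -/
def starSupp {X : GeometricData V N L} (x : Site X) : Set (Site X) :=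
  {x} ∪ {z | incidence X z.2 x.2 ≠ 0}

/-- The support of `B_x^0`: `x` and its boundary. -/
def plaquetteSupp {X : GeometricData V N L} (x : Site X) : Set (Site X) :=
  {x} ∪ {y | incidence X x.2 y.2 ≠ 0}

open Classical in
/-- The local Hamiltonian `H^Λ`. -/
def hamiltonian (X : GeometricData V N L) (G : AlgebraicData.{v} N) (Λ : Finset (Site X)) :
    QL X G :=
  -((∑ x ∈ Λ with starSupp x ⊆ (Λ : Set (Site X)), starOp G x) +
    ∑ y ∈ Λ with plaquetteSupp y ⊆ (Λ : Set (Site X)), plaquetteOp G y)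

/-- The derivation `δ(a) = i [H^Λ, a]` for a local observable `a` and all large enough `Λ`: on
local observables the net is eventually constant, and `δ(a)` is its limit. -/
def derivation (X : GeometricData V N L) (G : AlgebraicData.{v} N) (a : QL X G) : QL X G :=
  Filter.limUnder Filter.atTop fun Λ : Finset (Site X) =>
    Complex.I • (hamiltonian X G Λ * a - a * hamiltonian X G Λ)

/-- A state: a positive linear functional with value `1` at the unit. -/
structure State (A : Type*) [Ring A] [StarRing A] [Algebra ℂ A] where
  toLinearMap : A →ₗ[ℂ] ℂ
  map_one : toLinearMap 1 = 1
  nonneg : ∀ a, 0 ≤ toLinearMap (star a * a)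

instance {A : Type*} [Ring A] [StarRing A] [Algebra ℂ A] : CoeFun (State A) (fun _ => A → ℂ) where
  coe ω := ω.toLinearMap

/-- The restriction of a state to a unital `*`-subalgebra. -/
def State.restrict {A : Type*} [Ring A] [StarRing A] [Algebra ℂ A] [StarModule ℂ A]
    (S : StarSubalgebra ℂ A) (ω : State A) : State S where
  toLinearMap := ω.toLinearMap.comp S.subtype.toAlgHom.toLinearMap
  map_one := by simpa using ω.map_one
  nonneg a := by simpa using ω.nonneg a.1

/-- Ground states: `-i ω(a^* δ(a)) ≥ 0` for every local observable `a`. -/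
def IsGroundState {X : GeometricData V N L} {G : AlgebraicData.{v} N} (ω : State (QL X G)) :
    Prop :=
  ∀ a ∈ localObservables X G, 0 ≤ -Complex.I * ω (star a * derivation X G a)

/-- The set of frustration-free ground states. -/
def FG (X : GeometricData V N L) (G : AlgebraicData.{v} N) : Set (State (QL X G)) :=
  {ω | IsGroundState ω ∧ (∀ x : Site X, ω (starOp G x) = 1) ∧
    ∀ y : Site X, ω (plaquetteOp G y) = 1}

/-! ### Core, seed state and commutant -/

/-- The core `𝔎`: the `C^*`-subalgebra of `𝔄` generated by all `A_t` and `B_γ`. -/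
def core (X : GeometricData V N L) (G : AlgebraicData.{v} N) : StarSubalgebra ℂ (QL X G) :=
  (StarAlgebra.adjoin ℂ
    (Set.range (gaugeA (X := X) (G := G)) ∪ Set.range (gaugeB (X := X) (G := G)))).topologicalClosure

theorem gaugeA_mem_core {X : GeometricData V N L} {G : AlgebraicData.{v} N}
    (t : PMap₀ X G (-1)) : gaugeA t ∈ core X G :=
  StarSubalgebra.le_topologicalClosure _
    (StarAlgebra.subset_adjoin ℂ _ (Or.inl (Set.mem_range_self t)))

theorem gaugeB_mem_core {X : GeometricData V N L} {G : AlgebraicData.{v} N}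
    (γ : DualPMap₀ X G 1) : gaugeB γ ∈ core X G :=
  StarSubalgebra.le_topologicalClosure _
    (StarAlgebra.subset_adjoin ℂ _ (Or.inr (Set.mem_range_self γ)))

/-- The conditions `ϑ(A_t B_γ) = 1` defining the seed state on `𝔎`. -/
def IsSeed {X : GeometricData V N L} {G : AlgebraicData.{v} N} (ϑ : State (core X G)) : Prop :=
  ∀ (t : PMap₀ X G (-1)) (γ : DualPMap₀ X G 1),
    ϑ ⟨gaugeA t * gaugeB γ, mul_mem (gaugeA_mem_core t) (gaugeB_mem_core γ)⟩ = 1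

/-- The commutant `𝔎'` of the core in `𝔄`. -/
def commutant (X : GeometricData V N L) (G : AlgebraicData.{v} N) : StarSubalgebra ℂ (QL X G) :=
  StarSubalgebra.centralizer ℂ (core X G : Set (QL X G))

/-- The set of states on `𝔎'` whose restriction to `𝔎` is `ϑ`. -/
def statesOver {X : GeometricData V N L} {G : AlgebraicData.{v} N} (ϑ : State (core X G)) :
    Set (State (commutant X G)) :=
  {τ | ∀ (a : QL X G) (h : a ∈ core X G) (h' : a ∈ commutant X G), τ ⟨a, h'⟩ = ϑ ⟨a, h⟩}

end HAQDM

end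

/-! Call a state on the quasi-local algebra gauge invariant if it takes the value 1 at all A_t and
all B_γ. The theorem identifies both the frustration-free ground states and the extensions of states
in S_ϑ(𝔎') with the gauge-invariant states.

The basic tool is Cauchy–Schwarz: if u is unitary and ω(u) = 1, then ω((u - 1)*(u - 1)) = 0, so
ω(au) = ω(a) = ω(ua) for every a (`State.map_mul_unitary`, `State.map_unitary_mul`). A Weyl monomial
commutes with each A_t and B_γ up to a phase. If one of these phases differs from 1, a
gauge-invariant state vanishes on the monomial (`IsGaugeInvariant.map_weyl_eq_zero`); if all are 1,
the monomial lies in 𝔎' (`mem_commutant_iff`). The monomials span a dense subspace, because Fourier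
inversion on finite groups writes matrix units as combinations of them (`IsSupportedOn.mem_span`).
So a gauge-invariant state is determined by its restriction to 𝔎', and the stated formula holds.

Extensions from 𝔎' exist by Hahn–Banach, since a unital contractive functional is positive
(`State.exists_extension`). They are gauge invariant because 𝔎 ⊆ 𝔎', which comes from δ⁰δ⁻¹ = 0 and
the transposition rule (`delta_delta`, `pairing_dualDelta`).

For ground states, an average of numbers in the unit disc equals 1 only if each of them does, so
ω(A⁰_x) = ω(B⁰_x) = 1 forces gauge invariance (`isGaugeInvariant_of_mem_FG`). Conversely, each A⁰_x
and B⁰_x is a projection of expectation 1 and contributes nonnegatively to the ground state form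
(`State.nonneg_commutator`).

The seed state is a limit of vector states given by uniform superpositions over finite gauge orbits
(`exists_invariant_vector`); it is unique because the products A_tB_γ span a dense subspace of 𝔎. -/

noncomputable section

namespace HAQDM

universe u v

namespace State

/-! ### States on *-algebras and unitaries of expectation one -/

section Algebraic

variable {A : Type*} [Ring A] [StarRing A] [Algebra ℂ A]

theorem ext {ω ω' : State A} (h : ∀ a, ω a = ω' a) : ω = ω' := by
  cases ω; cases ω'
  congr
  exact LinearMap.ext h

variable [StarModule ℂ A] (ω : State A)

/-- ω is real at b*b for b = 1 + a, 1 + ia and a; comparing imaginary parts is enough. -/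
theorem map_star (a : A) : ω (star a) = star (ω a) := by
  have h1 := (Complex.le_def.mp (ω.nonneg (1 + a))).2
  have h2 := (Complex.le_def.mp (ω.nonneg (1 + Complex.I • a))).2
  have h3 := (Complex.le_def.mp (ω.nonneg a)).2
  simp only [star_add, star_one, star_smul, mul_add, add_mul, one_mul, mul_one, map_add, ω.map_one,
    smul_mul_smul_comm, map_smul, Complex.add_im, Complex.one_im, Complex.zero_im, smul_eq_mul,
    Complex.star_def, Complex.conj_I, Complex.mul_im, Complex.neg_re, Complex.neg_im, Complex.I_re,
    Complex.I_im, Complex.mul_re] at h1 h2 h3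
  apply Complex.ext <;> simp <;> linarith

/-- The degenerate case of Cauchy–Schwarz. Positivity at a* - r z̄ b, with z = ω(ab), has no term
quadratic in r, so letting r grow forces z = 0. -/
theorem map_mul_eq_zero {b : A} (hb : ω (star b * b) = 0) (a : A) : ω (a * b) = 0 := by
  by_contra hz
  set z := ω (a * b) with hzdef
  have hz' : ω (star b * star a) = star z := by rw [← star_mul, ω.map_star]
  have key : ∀ r : ℝ, 0 ≤ (ω (a * star a)).re - 2 * r * Complex.normSq z := by
    intro r
    have h := (Complex.le_def.mp (ω.nonneg (star a + (-(r : ℂ) * star z) • b))).1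
    have e : ω (star (star a + (-(r : ℂ) * star z) • b) * (star a + (-(r : ℂ) * star z) • b)) =
        ω (a * star a) + (-(r : ℂ) * star z) * z + (-(r : ℂ) * z) * star z := by
      simp only [star_add, star_star, star_smul, mul_add, add_mul, map_add, map_smul,
        smul_mul_assoc, mul_smul_comm, hb, hz', smul_eq_mul, ← hzdef]
      simp
      ring
    rw [e] at h
    simp [Complex.normSq_apply] at h ⊢
    linarith
  have hp : 0 < Complex.normSq z := Complex.normSq_pos.mpr hz
  have h1 := key (((ω (a * star a)).re + 1) / (2 * Complex.normSq z))
  field_simp at h1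
  linarith

theorem map_mul_unitary {u : A} (hu : u ∈ unitary A) (h : ω u = 1) (a : A) :
    ω (a * u) = ω a := by
  have h0 : ω (star (u - 1) * (u - 1)) = 0 := by
    have : star (u - 1) * (u - 1) = 1 + 1 - star u - u := by
      simp only [star_sub, star_one, mul_sub, sub_mul, one_mul, mul_one,
        Unitary.star_mul_self_of_mem hu]
      abel
    rw [this]
    simp [ω.map_star, h, ω.map_one]
  have h1 := ω.map_mul_eq_zero h0 a
  rw [mul_sub, mul_one, map_sub, sub_eq_zero] at h1
  exact h1

theorem map_unitary_mul {u : A} (hu : u ∈ unitary A) (h : ω u = 1) (a : A) :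
    ω (u * a) = ω a := by
  have h1 := ω.map_mul_unitary (Unitary.star_mem hu) (by rw [ω.map_star, h, star_one]) (star a)
  rw [← star_mul, ω.map_star, ω.map_star] at h1
  exact star_injective h1

/-- Invariance on both sides gives ω(a) = ω(ua) = c ω(au) = c ω(a). -/
theorem map_eq_zero_of_unitary {u a : A} (hu : u ∈ unitary A) (h : ω u = 1) {c : ℂ} (hc : c ≠ 1)
    (ha : u * a = c • (a * u)) : ω a = 0 := by
  have h1 := ω.map_unitary_mul hu h a
  rw [ha, map_smul, ω.map_mul_unitary hu h, smul_eq_mul] at h1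
  have : (c - 1) * ω a = 0 := by linear_combination h1
  exact (mul_eq_zero.mp this).resolve_left (sub_ne_zero.mpr hc)

end Algebraic

/-! ### States on C*-algebras: contractivity, positivity, extension -/

section CStar

variable {A : Type*} [CStarAlgebra A]

/-- In the spectral order ‖a‖² - a*a is positive, hence of the form b*b, where the algebraic
positivity of ω applies. -/
theorem map_star_mul_self_le (ω : State A) (a : A) : ω (star a * a) ≤ ((‖a‖ ^ 2 : ℝ) : ℂ) := by
  let _ : PartialOrder A := CStarAlgebra.spectralOrder A
  have _ : StarOrderedRing A := CStarAlgebra.spectralOrderedRing A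
  have h := sub_nonneg.mpr (CStarAlgebra.star_mul_le_algebraMap_norm_sq (a := a))
  obtain ⟨b, hb⟩ := CStarAlgebra.nonneg_iff_eq_star_mul_self.mp h
  have h2 := ω.nonneg b
  rw [← hb, map_sub, sub_nonneg] at h2
  refine h2.trans_eq ?_
  rw [Algebra.algebraMap_eq_smul_one, ← algebraMap_smul ℂ (‖a‖ ^ 2 : ℝ) (1 : A), map_smul,
    ω.map_one]
  simp

/-- The variance of a in the state ω is nonnegative, so |ω(a)|² ≤ ω(a*a). -/
theorem norm_map_le (ω : State A) (a : A) : ‖ω a‖ ≤ ‖a‖ := by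
  have h0 : 0 ≤ ω (star (a - algebraMap ℂ A (ω a)) * (a - algebraMap ℂ A (ω a))) := ω.nonneg _
  have e : ω (star (a - algebraMap ℂ A (ω a)) * (a - algebraMap ℂ A (ω a))) =
      ω (star a * a) - ((‖ω a‖ ^ 2 : ℝ) : ℂ) := by
    simp only [Algebra.algebraMap_eq_smul_one, star_sub, star_smul, star_one, mul_sub, sub_mul,
      smul_mul_assoc, mul_smul_comm, one_mul, mul_one, map_sub, map_smul, ω.map_one, ω.map_star,
      smul_eq_mul]
    have := Complex.conj_mul' (ω a)
    simp only [Complex.star_def]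
    push_cast
    linear_combination -this
  rw [e, sub_nonneg] at h0
  have h1 := h0.trans (ω.map_star_mul_self_le a)
  rw [Complex.real_le_real] at h1
  exact (pow_le_pow_iff_left₀ (norm_nonneg _) (norm_nonneg _) two_ne_zero).mp h1

theorem continuous (ω : State A) : Continuous ω :=
  AddMonoidHomClass.continuous_of_bound ω.toLinearMap 1 (fun a => by simpa using ω.norm_map_le a)

/-- For real t, ‖a + it‖² ≤ ‖a‖² + t², whereas |f(a) + it|² contains t² + 2t Im f(a). The t² cancel
and a linear function of t stays bounded above. -/
theorem im_eq_zero_of_norm_le {f : A →ₗ[ℂ] ℂ} (h1 : f 1 = 1) (hf : ∀ a, ‖f a‖ ≤ ‖a‖) {a : A}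
    (ha : IsSelfAdjoint a) : (f a).im = 0 := by
  have key : ∀ t : ℝ, 2 * t * (f a).im ≤ ‖a‖ ^ 2 := by
    intro t
    have h2 := hf (a + (t * Complex.I : ℂ) • 1)
    have h3 : ‖a + (t * Complex.I : ℂ) • (1 : A)‖ ^ 2 ≤ ‖a‖ ^ 2 + t ^ 2 := by
      rw [sq, ← CStarRing.norm_star_mul_self]
      have e : star (a + (t * Complex.I : ℂ) • (1 : A)) * (a + (t * Complex.I : ℂ) • (1 : A)) =
          a * a + ((t ^ 2 : ℝ) : ℂ) • (1 : A) := by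
        simp only [star_add, ha.star_eq, star_smul, star_one, mul_add, add_mul, smul_mul_assoc,
          mul_smul_comm, one_mul, mul_one]
        have e2 : (t * Complex.I : ℂ) * star (t * Complex.I : ℂ) = ((t ^ 2 : ℝ) : ℂ) := by
          simp only [Complex.star_def, map_mul, Complex.conj_ofReal, Complex.conj_I]
          push_cast
          linear_combination -(t : ℂ) ^ 2 * Complex.I_sq
        have e3 : star (t * Complex.I : ℂ) = -(t * Complex.I : ℂ) := by simp
        rw [smul_add, smul_smul, e2, e3]
        module
      rw [e]
      refine (norm_add_le _ _).trans (add_le_add ((norm_mul_le _ _).trans_eq (sq _).symm) ?_)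
      refine (norm_smul_le _ _).trans ?_
      rcases subsingleton_or_nontrivial A with hA | hA
      · rw [Subsingleton.elim (1 : A) 0, norm_zero, mul_zero]; positivity
      · rw [CStarRing.norm_one, mul_one, Complex.norm_real, Real.norm_of_nonneg (sq_nonneg t)]
    have h4 : ‖f (a + (t * Complex.I : ℂ) • 1)‖ ^ 2 ≤ ‖a‖ ^ 2 + t ^ 2 :=
      (pow_le_pow_left₀ (norm_nonneg _) h2 2).trans h3
    rw [map_add, map_smul, h1, ← Complex.normSq_eq_norm_sq, Complex.normSq_apply] at h4
    simp at h4
    nlinarith [sq_nonneg (f a).re, sq_nonneg (f a).im]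
  by_contra hne
  have h2 := key ((‖a‖ ^ 2 + 1) / (2 * (f a).im))
  field_simp at h2
  linarith

/-- The element ‖a‖² - a*a has norm at most ‖a‖², so contractivity gives ‖a‖² - Re f(a*a) ≤ ‖a‖². -/
theorem nonneg_of_norm_le {f : A →ₗ[ℂ] ℂ} (h1 : f 1 = 1) (hf : ∀ a, ‖f a‖ ≤ ‖a‖) (a : A) :
    0 ≤ f (star a * a) := by
  let _ : PartialOrder A := CStarAlgebra.spectralOrder A
  have _ : StarOrderedRing A := CStarAlgebra.spectralOrderedRing A
  have him := im_eq_zero_of_norm_le h1 hf (IsSelfAdjoint.star_mul_self a)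
  have h2 : ‖algebraMap ℝ A (‖a‖ ^ 2) - star a * a‖ ≤ ‖a‖ ^ 2 := by
    refine (CStarAlgebra.norm_le_iff_le_algebraMap _ (sq_nonneg _)
      (sub_nonneg.mpr CStarAlgebra.star_mul_le_algebraMap_norm_sq)).mpr ?_
    exact sub_le_self _ (star_mul_self_nonneg a)
  have h3 := (Complex.re_le_norm _).trans ((hf _).trans h2)
  rw [map_sub, Algebra.algebraMap_eq_smul_one, ← algebraMap_smul ℂ (‖a‖ ^ 2 : ℝ) (1 : A), map_smul,
    h1] at h3
  rw [Complex.le_def]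
  refine ⟨?_, him.symm⟩
  simp at h3 ⊢
  rw [← Complex.ofReal_pow, Complex.ofReal_re] at h3
  linarith

/-- A unital contractive functional is a state. -/
def ofNormLe (f : A →ₗ[ℂ] ℂ) (h1 : f 1 = 1) (hf : ∀ a, ‖f a‖ ≤ ‖a‖) : State A where
  toLinearMap := f
  map_one := h1
  nonneg := nonneg_of_norm_le h1 hf

/-- A state has norm at most 1; its norm-preserving Hahn–Banach extension is unital and contractive,
hence positive. -/
theorem exists_extension (S : StarSubalgebra ℂ A) (hS : IsClosed (S : Set A)) (τ : State S) :
    ∃ ω : State A, ω.restrict S = τ := by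
  have : IsClosed (S : Set A) := hS
  let f : StrongDual ℂ (S.toSubalgebra.toSubmodule) :=
    LinearMap.mkContinuous τ.toLinearMap 1 
      (fun a => by rw [one_mul]; exact τ.norm_map_le a)
  obtain ⟨g, hg, hn⟩ := exists_extension_norm_eq _ f
  have hf : ‖f‖ ≤ 1 := LinearMap.mkContinuous_norm_le _ zero_le_one _
  have hg' : ∀ a : S, g a.1 = τ a := fun a => hg a
  refine ⟨ofNormLe g.toLinearMap ?_ ?_, ?_⟩
  · simpa [τ.map_one] using hg' 1
  · intro a
    refine (g.le_opNorm a).trans ?_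
    rw [hn]
    exact mul_le_of_le_one_left (norm_nonneg _) hf
  · exact State.ext hg'

end CStar

end State

/-! ### Averages of unitary representations of finite groups -/

section Average

variable {A : Type*} [Ring A] [Algebra ℂ A] {Γ : Type*} [AddCommGroup Γ] [Finite Γ]

/-- The average of a family of elements over a finite group. -/
def average (U : Γ → A) : A := (Nat.card Γ : ℂ)⁻¹ • ∑ᶠ g, U g

theorem card_cast_ne_zero : (Nat.card Γ : ℂ) ≠ 0 := Nat.cast_ne_zero.mpr Nat.card_pos.ne'

theorem star_average [StarRing A] [StarModule ℂ A] {U : Γ → A} (hs : ∀ g, star (U g) = U (-g)) :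
    star (average U) = average U := by
  have := Fintype.ofFinite Γ
  rw [average, star_smul, finsum_eq_sum_of_fintype, star_sum]
  simp only [hs, star_inv₀, star_natCast]
  congr 1
  exact Equiv.sum_comp (Equiv.neg Γ) U

theorem average_mul_self {U : Γ → A} (hU : ∀ g h, U (g + h) = U g * U h) :
    average U * average U = average U := by
  have := Fintype.ofFinite Γ
  have h1 : ∀ g, U g * ∑ h, U h = ∑ h, U h := fun g => by
    rw [Finset.mul_sum]
    simp_rw [← hU]
    exact Equiv.sum_comp (Equiv.addLeft g) U
  rw [average, finsum_eq_sum_of_fintype, smul_mul_smul_comm, Finset.sum_mul]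
  simp only [h1, Finset.sum_const, Finset.card_univ, ← Nat.card_eq_fintype_card]
  rw [← Nat.cast_smul_eq_nsmul ℂ, smul_smul, mul_assoc, inv_mul_cancel₀ card_cast_ne_zero, mul_one]

theorem commute_average {Γ : Type*} [Finite Γ] {U : Γ → A} {a : A} (h : ∀ g, Commute (U g) a) :
    Commute (average U) a := by
  have := Fintype.ofFinite Γ
  rw [average, finsum_eq_sum_of_fintype]
  exact (Commute.sum_left _ _ _ fun g _ => h g).smul_left _

theorem State.map_average [StarRing A] {U : Γ → A} (ω : State A) (h : ∀ g, ω (U g) = 1) :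
    ω (average U) = 1 := by
  have := Fintype.ofFinite Γ
  rw [average, finsum_eq_sum_of_fintype, map_smul, map_sum]
  simp [h, ← Nat.card_eq_fintype_card]

/-- 1 is an extreme point of the unit disc: the real parts are at most 1 and average to 1, so all
equal 1, and then the imaginary parts vanish. -/
theorem State.map_eq_one_of_average [StarRing A] {U : Γ → A} (ω : State A)
    (hU : ∀ g, ‖ω (U g)‖ ≤ 1) (h : ω (average U) = 1) (g : Γ) : ω (U g) = 1 := by
  have := Fintype.ofFinite Γ
  rw [average, finsum_eq_sum_of_fintype, map_smul, map_sum, smul_eq_mul,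
    inv_mul_eq_iff_eq_mul₀ card_cast_ne_zero, mul_one] at h
  have hre : ∀ g, (ω (U g)).re ≤ 1 := fun g => (Complex.re_le_norm _).trans (hU g)
  have h2 : ∑ g, (1 - (ω (U g)).re) = 0 := by
    have := congrArg Complex.re h
    rw [Complex.re_sum] at this
    rw [Finset.sum_sub_distrib, this]
    simp [← Nat.card_eq_fintype_card]
  have h3 := (Finset.sum_eq_zero_iff_of_nonneg (fun g _ => sub_nonneg.mpr (hre g))).mp h2 g
    (Finset.mem_univ g)
  have h4 : (ω (U g)).re = 1 := by linarith
  have h5 := hU g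
  have h6 : Complex.normSq (ω (U g)) ≤ 1 := by
    rw [Complex.normSq_eq_norm_sq]; exact pow_le_one₀ (norm_nonneg _) h5
  rw [Complex.normSq_apply, h4] at h6
  have h7 : (ω (U g)).im = 0 := by nlinarith
  exact Complex.ext (by simpa using h4) (by simpa using h7)

end Average

section

variable {V : Type u} [LinearOrder V] {N L : ℕ}

/-! ### Incidence numbers and ∂∂ = 0 -/

section Simplicial

variable (X : GeometricData V N L)

/-- The sign of the face of `s` opposite to `v`. -/
def faceSign (s : Finset V) (v : V) : ℤ := (-1) ^ (s.filter (fun w => w < v)).card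

/-- Deleting the smaller vertex v lowers the position of w by one, while deleting w does not move v.
-/
theorem faceSign_antisymm {s : Finset V} {v w : V} (hv : v ∈ s) (hvw : v < w) :
    faceSign s v * faceSign (s.erase v) w + faceSign s w * faceSign (s.erase w) v = 0 := by
  have h1 : (s.erase w).filter (fun u => u < v) = s.filter (fun u => u < v) := by
    ext u
    simp only [Finset.mem_filter, Finset.mem_erase]
    constructor
    · rintro ⟨⟨_, h⟩, h'⟩; exact ⟨h, h'⟩
    · rintro ⟨h, h'⟩; exact ⟨⟨(h'.trans hvw).ne, h⟩, h'⟩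
  have h2 : (s.erase v).filter (fun u => u < w) = (s.filter (fun u => u < w)).erase v :=
    Finset.filter_erase _ _ _
  have h3 : ((s.filter (fun u => u < w)).erase v).card + 1 = (s.filter (fun u => u < w)).card :=
    Finset.card_erase_add_one (Finset.mem_filter.mpr ⟨hv, hvw⟩)
  simp only [faceSign, h1, h2, ← h3, pow_succ]
  ring

theorem incidence_erase {m n : ℤ} (z : Simplex X m) (x : Simplex X n) {v : V} (hv : v ∈ z.1)
    (h : z.1.erase v = x.1) : incidence X z x =
      (X.orient ⟨z.1, z.2.1⟩ : ℤ) * (X.orient ⟨x.1, x.2.1⟩ : ℤ) * faceSign z.1 v := by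
  rw [incidence, Finset.sum_eq_single_of_mem v hv, if_pos h, faceSign]
  intro w hw hne
  rw [if_neg]
  intro h'
  have := Finset.notMem_erase w z.1
  rw [h', ← h] at this
  exact this (Finset.mem_erase.mpr ⟨hne, hw⟩)

/-- The sum over intermediate simplices of products of incidence numbers vanishes. -/
theorem sum_incidence_mul_incidence {l m n : ℤ} (hm : m + 1 = l) (hn : n + 1 = m)
    (x : Simplex X l) (y : Simplex X n) (S : Finset (Simplex X m))
    (hS : ∀ z, incidence X x z ≠ 0 → z ∈ S) :
    ∑ z ∈ S, incidence X x z * incidence X z y = 0 := by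
  classical
  -- Unless y arises from x by deleting two vertices, every summand vanishes. If it does, exactly
  -- two intermediate simplices contribute.
  by_cases hxy : ∃ v ∈ x.1, ∃ w ∈ x.1, v < w ∧ (x.1.erase v).erase w = y.1
  swap
  · refine Finset.sum_eq_zero fun z _ => ?_
    by_contra hne
    obtain ⟨v, hv, h⟩ := exists_of_incidence_ne_zero X (left_ne_zero_of_mul hne)
    obtain ⟨w, hw, h'⟩ := exists_of_incidence_ne_zero X (right_ne_zero_of_mul hne)
    rw [← h, Finset.mem_erase] at hw
    rw [← h] at h'
    rcases lt_or_gt_of_ne hw.1 with hlt | hlt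
    · exact hxy ⟨w, hw.2, v, hv, hlt, by rw [Finset.erase_right_comm, h']⟩
    · exact hxy ⟨v, hv, w, hw.2, hlt, h'⟩
  obtain ⟨v, hv, w, hw, hvw, hy⟩ := hxy
  have hy' : (x.1.erase w).erase v = y.1 := by rw [Finset.erase_right_comm, hy]
  have hwv : w ∈ x.1.erase v := Finset.mem_erase.mpr ⟨hvw.ne', hw⟩
  have hvw' : v ∈ x.1.erase w := Finset.mem_erase.mpr ⟨hvw.ne, hv⟩
  have hface : ∀ a ∈ x.1, (x.1.erase a).Nonempty →
      x.1.erase a ∈ X.complex.faces ∧ ((x.1.erase a).card : ℤ) = m + 1 := by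
    intro a ha hne
    refine ⟨(X.complex.isRelLowerSet_faces x.2.1).2 (Finset.erase_subset _ _) hne, ?_⟩
    have h1 := Finset.card_erase_add_one ha
    have h2 := x.2.2
    omega
  let zv : Simplex X m := ⟨x.1.erase v, hface v hv ⟨w, hwv⟩⟩
  let zw : Simplex X m := ⟨x.1.erase w, hface w hw ⟨v, hvw'⟩⟩
  have hxv : incidence X x zv = _ := incidence_erase X x zv hv rfl
  have hxw : incidence X x zw = _ := incidence_erase X x zw hw rfl
  have hvy : incidence X zv y = _ := incidence_erase X zv y hwv hy
  have hwy : incidence X zw y = _ := incidence_erase X zw y hvw' hy'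
  have hne : zv ≠ zw := by
    intro h
    have : x.1.erase v = x.1.erase w := congrArg Subtype.val h
    rw [this] at hwv
    exact Finset.notMem_erase _ _ hwv
  have hsign : ∀ (s : Finset V) (a : V), faceSign s a ≠ 0 := fun s a => pow_ne_zero _ (by norm_num)
  -- An intermediate simplex x ∖ {a} has a ∉ y = x ∖ {v, w}, so a is v or w.
  have hnz : ∀ z, incidence X x z * incidence X z y ≠ 0 → z = zv ∨ z = zw := by
    intro z hz
    obtain ⟨a, ha, h⟩ := exists_of_incidence_ne_zero X (left_ne_zero_of_mul hz)
    obtain ⟨b, hb, h'⟩ := exists_of_incidence_ne_zero X (right_ne_zero_of_mul hz)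
    have ha' : a ∉ y.1 := by rw [← h', ← h]; simp
    rw [← hy] at ha'
    simp only [Finset.mem_erase, not_and, ha, not_true_eq_false, imp_false] at ha'
    by_cases haw : a = w
    · right; exact Subtype.ext (by rw [← h, haw])
    · left
      have hav := ha' haw
      rw [not_not] at hav
      exact Subtype.ext (by rw [← h, hav])
  have hS' : ∑ z ∈ S, incidence X x z * incidence X z y =
      ∑ z ∈ {zv, zw}, incidence X x z * incidence X z y := by
    refine Finset.sum_subset_zero_on_sdiff ?_ ?_ ?_ |>.symm
    · intro z hz
      refine hS z ?_
      rcases Finset.mem_insert.mp hz with rfl | hz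
      · rw [hxv]; simp [hsign]
      · rw [Finset.mem_singleton.mp hz, hxw]; simp [hsign]
    · intro z hz
      by_contra hc
      exact (Finset.mem_sdiff.mp hz).2 (by simpa using hnz z hc)
    · intros; rfl
  rw [hS', Finset.sum_pair hne, hxv, hxw, hvy, hwy]
  have h1 : ((X.orient ⟨zv.1, zv.2.1⟩ : ℤˣ) : ℤ) * (X.orient ⟨zv.1, zv.2.1⟩ : ℤ) = 1 :=
    Int.units_coe_mul_self _
  have h2 : ((X.orient ⟨zw.1, zw.2.1⟩ : ℤˣ) : ℤ) * (X.orient ⟨zw.1, zw.2.1⟩ : ℤ) = 1 :=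
    Int.units_coe_mul_self _
  have h3 := faceSign_antisymm hv hvw
  change _ * faceSign x.1 v * (_ * faceSign (x.1.erase v) w) +
    _ * faceSign x.1 w * (_ * faceSign (x.1.erase w) v) = 0
  set ox := (X.orient ⟨x.1, x.2.1⟩ : ℤ)
  set oy := (X.orient ⟨y.1, y.2.1⟩ : ℤ)
  -- The orientation sign of each intermediate simplex occurs twice and squares to 1; what remains
  -- is the antisymmetry of the face signs.
  linear_combination ox * oy * faceSign x.1 v * faceSign (x.1.erase v) w * h1 +
    ox * oy * faceSign x.1 w * faceSign (x.1.erase w) v * h2 + ox * oy * h3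

theorem hom_apply_eq_sum {n : ℤ} {A : Type*} [AddCommGroup A] (f : Chain X n →+ A)
    (c : Chain X n) : f c = ∑ y ∈ c.support, c y • f (Finsupp.single y 1) := by
  conv_lhs => rw [← Finsupp.sum_single c, Finsupp.sum, map_sum]
  refine Finset.sum_congr rfl fun y _ => ?_
  rw [← map_zsmul, Finsupp.smul_single, smul_eq_mul, mul_one]

theorem chain_hom_ext {n : ℤ} {A : Type*} [AddCommGroup A] {f g : Chain X n →+ A}
    (h : ∀ y, f (Finsupp.single y 1) = g (Finsupp.single y 1)) : f = g := by
  refine AddMonoidHom.ext fun c => ?_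
  rw [hom_apply_eq_sum X f, hom_apply_eq_sum X g]
  simp only [h]

theorem boundary_boundary {l m n : ℤ} (hm : m + 1 = l) (hn : n + 1 = m) :
    (boundary X m n).comp (boundary X l m) = 0 := by
  refine chain_hom_ext X fun x => ?_
  ext y
  rw [AddMonoidHom.comp_apply, hom_apply_eq_sum, Finsupp.finsetSum_apply]
  simp only [Finsupp.smul_apply, boundary_single_apply, smul_eq_mul, AddMonoidHom.zero_apply,
    Finsupp.coe_zero, Pi.zero_apply]
  refine sum_incidence_mul_incidence X hm hn x y _ fun z hz => ?_
  rwa [Finsupp.mem_support_iff, boundary_single_apply]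

end Simplicial

/-! ### Transport between equal degrees, and δδ = 0 -/

section Casts

variable (G : AlgebraicData.{v} N)

theorem AlgebraicData.cast_cast {i j k : ℤ} (h : i = j) (h' : j = k) (g : G.grp i) :
    G.cast h' (G.cast h g) = G.cast (h.trans h') g := by
  subst h h'; rfl

theorem AlgebraicData.d_cast {i j : ℤ} (h : i = j) (h' : i + 1 = j + 1) (g : G.grp (i + 1)) :
    G.d j (G.cast h' g) = G.cast h (G.d i g) := by
  subst h; rfl

theorem AlgebraicData.dualCast_apply_cast {i j : ℤ} (h : i = j) (h' : j = i) (α : G.dual i)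
    (g : G.grp j) : G.dualCast h α g = α (G.cast h' g) := by
  subst h; rfl

end Casts

/-- The pure terms vanish by ∂∂ = 0 on chains and on the coefficient complex. The two mixed terms
agree up to transport and carry the opposite signs (-1)^p and (-1)^(p+1). -/
theorem delta_delta (X : GeometricData V N L) (G : AlgebraicData.{v} N) {p q r : ℤ}
    (h : p + 1 = q) (h' : q + 1 = r) (t : PMap X G p) : delta X G h' (delta X G h t) = 0 := by
  subst h h'
  funext n
  refine AddMonoidHom.ext fun c => ?_
  have hb : boundary X (n - 1) (n - 1 - 1) (boundary X n (n - 1) c) = 0 :=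
    DFunLike.congr_fun (boundary_boundary X (by ring : n - 1 + 1 = n) (by ring)) c
  simp only [delta, AddMonoidHom.sub_apply, AddMonoidHom.comp_apply, AddMonoidHom.smul_apply,
    map_sub, map_zsmul, hb, map_zero, Pi.zero_apply, AddMonoidHom.zero_apply]
  have e1 : ∀ g, G.cast (by ring : n - 1 - (p + 1) = n - (p + 1 + 1)) (G.d (n - 1 - (p + 1)) g) =
      G.d (n - (p + 1 + 1)) (G.cast (by ring) g) := fun g => (G.d_cast _ _ _).symm
  have e2 : ∀ g, G.d (n - (p + 1 + 1)) (G.cast (by ring)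
      (G.d (n - (p + 1)) g)) = 0 := fun g => by
    rw [← G.d_cast (by ring : n - (p + 1) = n - (p + 1 + 1) + 1) (by ring), G.d_comp_d]
  rw [e1, e2, G.cast_cast, G.cast_cast, Int.negOnePow_succ]
  simp

end

section

variable {V : Type u} [LinearOrder V] {N L : ℕ}

/-! ### Families given by their values at simplices -/

section Families

variable {X : GeometricData V N L} {A : ℤ → Type*} [∀ n, AddCommGroup (A n)]

theorem family_ext {s t : ∀ n, Chain X n →+ A n} (h : ∀ x, val s x = val t x) : s = t :=
  funext fun n => chain_hom_ext X fun y => h ⟨n, y⟩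

@[simp]
theorem val_zero (x : Site X) : val (0 : ∀ n, Chain X n →+ A n) x = 0 := rfl

theorem val_neg (t : ∀ n, Chain X n →+ A n) (x : Site X) : val (-t) x = -val t x := rfl

theorem val_sub (s t : ∀ n, Chain X n →+ A n) (x : Site X) : val (s - t) x = val s x - val t x :=
  rfl

theorem apply_of_single {n : ℤ} {z : Simplex X n} {t : ∀ n, Chain X n →+ A n}
    (h : ∀ y, y ≠ ⟨n, z⟩ → val t y = 0) (c : Chain X n) : t n c = c z • val t ⟨n, z⟩ := by
  rw [hom_apply_eq_sum]
  change ∑ y ∈ c.support, (c y • val t ⟨n, y⟩ : A n) = (c z • val t ⟨n, z⟩ : A n)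
  refine Finset.sum_eq_single z (fun y _ hy => ?_) (fun hz => ?_)
  · rw [h _ (fun he => hy (by simpa using he)), smul_zero]
  · rw [Finsupp.notMem_support_iff.mp hz, zero_smul]

theorem apply_eq_zero_of_ne {n : ℤ} {x : Site X} {t : ∀ n, Chain X n →+ A n}
    (h : ∀ y, y ≠ x → val t y = 0) (hn : x.1 ≠ n) (c : Chain X n) : t n c = 0 := by
  rw [hom_apply_eq_sum]
  refine Finset.sum_eq_zero fun y _ => ?_
  have : t n (Finsupp.single y 1) = 0 := h ⟨n, y⟩ (fun he => hn (by rw [← he]))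
  rw [this, smul_zero]

/-- The restriction of a family to a finite set of sites, extended by zero. -/
def cutoff (Λ : Finset (Site X)) (t : ∀ n, Chain X n →+ A n) : compactlySupported X A := by
  classical
  exact ⟨ofVal fun x => if x ∈ Λ then val t x else 0, Λ.finite_toSet.subset fun x hx => by
    by_contra hc
    exact hx (by rw [val_ofVal, if_neg (by simpa using hc)])⟩

theorem val_cutoff_of_mem {Λ : Finset (Site X)} (t : ∀ n, Chain X n →+ A n) {x : Site X}
    (hx : x ∈ Λ) : val (cutoff Λ t).1 x = val t x := by
  classical
  rw [cutoff, val_ofVal, if_pos hx]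

theorem val_cutoff_of_notMem {Λ : Finset (Site X)} (t : ∀ n, Chain X n →+ A n) {x : Site X}
    (hx : x ∉ Λ) : val (cutoff Λ t).1 x = 0 := by
  classical
  rw [cutoff, val_ofVal, if_neg hx]

/-- A compactly supported family is a finite sum of families concentrated at one simplex, so
additive identities need checking only there. -/
theorem compactlySupported_induction {P : compactlySupported X A → Prop} (zero : P 0)
    (add : ∀ s t, P s → P t → P (s + t))
    (single : ∀ (x : Site X) (t : compactlySupported X A), (∀ y, y ≠ x → val t.1 y = 0) → P t)
    (t : compactlySupported X A) : P t := by
  classical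
  have key : ∀ (Λ : Finset (Site X)) (t : compactlySupported X A),
      (∀ x ∉ Λ, val t.1 x = 0) → P t := by
    intro Λ
    induction Λ using Finset.induction_on with
    | empty =>
      intro t ht
      have : t = 0 := Subtype.ext (family_ext fun x => ht x (Finset.notMem_empty x))
      rwa [this]
    | insert a Λ ha ih =>
      intro t ht
      have e : t = cutoff {a} t.1 + (t - cutoff {a} t.1) := by abel
      rw [e]
      refine add _ _ (single a _ fun y hy => val_cutoff_of_notMem _ (by simpa using hy))
        (ih _ fun x hx => ?_)
      change val (t.1 - (cutoff {a} t.1).1) x = 0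
      rw [val_sub]
      by_cases hxa : x = a
      · rw [hxa, val_cutoff_of_mem _ (by simp), sub_self]
      · rw [val_cutoff_of_notMem _ (by simpa using hxa), sub_zero]
        exact ht x (by simp [hxa, hx])
  refine key (Set.Finite.toFinset (show {x : Site X | val t.1 x ≠ 0}.Finite from t.2)) t ?_
  intro x hx
  simpa using hx

variable (A) in
/-- The subgroup of families supported in a finite set of sites. -/
def supportedIn (Λ : Finset (Site X)) : AddSubgroup (compactlySupported X A) where
  carrier := {t | ∀ x ∉ Λ, val t.1 x = 0}
  zero_mem' := fun _ _ => rfl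
  add_mem' {a b} ha hb x hx := by
    rw [AddSubgroup.coe_add, val_add, ha x hx, hb x hx, add_zero]
  neg_mem' {a} ha x hx := by
    change val (-a.1) x = 0
    rw [val_neg, ha x hx, neg_zero]

instance finite_supportedIn [∀ n, Finite (A n)] (Λ : Finset (Site X)) :
    Finite (supportedIn A Λ) := by
  refine Finite.of_injective (fun t : supportedIn A Λ => fun x : Λ => val t.1.1 x.1) ?_
  intro s t hst
  refine Subtype.ext (Subtype.ext (family_ext fun x => ?_))
  by_cases hx : x ∈ Λ
  · exact congrFun hst ⟨x, hx⟩
  · rw [s.2 x hx, t.2 x hx]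

theorem cutoff_mem (Λ : Finset (Site X)) (t : ∀ n, Chain X n →+ A n) :
    cutoff Λ t ∈ supportedIn A Λ := fun _ hx => val_cutoff_of_notMem t hx

theorem exists_mem_supportedIn (t : compactlySupported X A) : ∃ Λ, t ∈ supportedIn A Λ :=
  ⟨Set.Finite.toFinset (show {x : Site X | val t.1 x ≠ 0}.Finite from t.2), fun x hx => by
    simpa using hx⟩

theorem supportedIn_mono {Λ Λ' : Finset (Site X)} (h : Λ ⊆ Λ') :
    supportedIn A Λ ≤ supportedIn A Λ' := fun _ ht x hx => ht x fun h' => hx (h h')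

end Families

/-! ### The pairing of maps with dual maps, and transposition -/

section Pairing

variable {X : GeometricData V N L} {G : AlgebraicData.{v} N} {p q : ℤ}

theorem val_localized_self (x : Site X) (g : G.grp (x.1 - p)) :
    val (localized X G x g).1 x = g := by
  classical
  rw [localized, val_ofVal, Pi.single_eq_same]

theorem val_localized_of_ne {x y : Site X} (h : y ≠ x) (g : G.grp (x.1 - p)) :
    val (localized X G x g).1 y = 0 := by
  classical
  rw [localized, val_ofVal, Pi.single_eq_of_ne h]

theorem val_dualLocalized_self (x : Site X) (α : G.dual (x.1 - p)) :
    val (dualLocalized X G x α).1 x = α := by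
  classical
  rw [dualLocalized, val_ofVal, Pi.single_eq_same]

theorem val_dualLocalized_of_ne {x y : Site X} (h : y ≠ x) (α : G.dual (x.1 - p)) :
    val (dualLocalized X G x α).1 y = 0 := by
  classical
  rw [dualLocalized, val_ofVal, Pi.single_eq_of_ne h]

theorem eq_localized {x : Site X} {t : PMap₀ X G p} (h : ∀ y, y ≠ x → val t.1 y = 0) :
    t = localized X G x (val t.1 x) := by
  refine Subtype.ext (family_ext fun y => ?_)
  by_cases hy : y = x
  · subst hy; rw [val_localized_self]
  · rw [h y hy, val_localized_of_ne hy]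

theorem eq_dualLocalized {x : Site X} {γ : DualPMap₀ X G p} (h : ∀ y, y ≠ x → val γ.1 y = 0) :
    γ = dualLocalized X G x (val γ.1 x) := by
  refine Subtype.ext (family_ext fun y => ?_)
  by_cases hy : y = x
  · subst hy; rw [val_dualLocalized_self]
  · rw [h y hy, val_dualLocalized_of_ne hy]

theorem localized_add (x : Site X) (g h : G.grp (x.1 - p)) :
    localized X G x (g + h) = localized X G x g + localized X G x h := by
  symm
  have e := eq_localized (x := x) (t := localized X G x g + localized X G x h) fun y hy => by
    rw [AddSubgroup.coe_add, val_add, val_localized_of_ne hy, val_localized_of_ne hy, add_zero]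
  rwa [AddSubgroup.coe_add, val_add, val_localized_self, val_localized_self] at e

theorem dualLocalized_add (x : Site X) (α β : G.dual (x.1 - p)) :
    dualLocalized X G x (α + β) = dualLocalized X G x α + dualLocalized X G x β := by
  symm
  have e := eq_dualLocalized (x := x) (γ := dualLocalized X G x α + dualLocalized X G x β)
    fun y hy => by
      rw [AddSubgroup.coe_add, val_add, val_dualLocalized_of_ne hy, val_dualLocalized_of_ne hy,
        add_zero]
  rwa [AddSubgroup.coe_add, val_add, val_dualLocalized_self, val_dualLocalized_self] at e

/-- Guards against the default value 1 of `finprod` on infinite supports, where multiplicativity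
could fail. -/
theorem mulSupport_pairing_finite (γ : DualPMap₀ X G p) (t : PMap X G p) :
    (Function.mulSupport fun x : Site X => (val γ.1 x) (val t x)).Finite :=
  Set.Finite.subset γ.2 fun x hx h => hx (by
    change (val γ.1 x) (val t x) = 1
    have h' : val γ.1 x = 0 := h
    rw [h', AddChar.zero_apply])

/-- The pairing with a compactly supported dual map, as a character. -/
def pairingChar (γ : DualPMap₀ X G p) : AddChar (PMap X G p) Circle where
  toFun t := pairing γ.1 t
  map_zero_eq_one' := finprod_eq_one_of_forall_eq_one fun x => by simp
  map_add_eq_mul' s t := by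
    rw [pairing, pairing, pairing, ← finprod_mul_distrib (mulSupport_pairing_finite γ s)
      (mulSupport_pairing_finite γ t)]
    exact finprod_congr fun x => by rw [val_add, AddChar.map_add_eq_mul]

/-- The evaluation of compactly supported dual maps at a map, as a character. -/
def evalChar (t : PMap X G p) : AddChar (DualPMap₀ X G p) Circle where
  toFun γ := pairing γ.1 t
  map_zero_eq_one' := finprod_eq_one_of_forall_eq_one fun x => by simp
  map_add_eq_mul' γ η := by
    rw [pairing, pairing, pairing, ← finprod_mul_distrib (mulSupport_pairing_finite γ t)
      (mulSupport_pairing_finite η t)]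
    exact finprod_congr fun x => by rw [AddSubgroup.coe_add, val_add, AddChar.add_apply]

theorem pairing_add_right (γ : DualPMap₀ X G p) (s t : PMap X G p) :
    pairing γ.1 (s + t) = pairing γ.1 s * pairing γ.1 t := (pairingChar γ).map_add_eq_mul s t

theorem pairing_zero_right (γ : DualPMap₀ X G p) : pairing γ.1 (0 : PMap X G p) = 1 :=
  (pairingChar γ).map_zero_eq_one

theorem pairing_add_left (γ η : DualPMap₀ X G p) (t : PMap X G p) :
    pairing (γ + η).1 t = pairing γ.1 t * pairing η.1 t := (evalChar t).map_add_eq_mul γ η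

theorem pairing_zero_left (t : PMap X G p) : pairing (0 : DualPMap₀ X G p).1 t = 1 :=
  (evalChar t).map_zero_eq_one

theorem pairing_eq_of_left {x : Site X} {γ : DualPMap X G p} (h : ∀ y, y ≠ x → val γ y = 0)
    (t : PMap X G p) : pairing γ t = (val γ x) (val t x) :=
  finprod_eq_single _ _ fun y hy => by rw [h y hy, AddChar.zero_apply]

theorem pairing_eq_of_right {x : Site X} {t : PMap X G p} (h : ∀ y, y ≠ x → val t y = 0)
    (γ : DualPMap X G p) : pairing γ t = (val γ x) (val t x) :=
  finprod_eq_single _ _ fun y hy => by rw [h y hy, AddChar.map_zero_eq_one]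

theorem val_delta (h : p + 1 = q) (t : PMap X G p) (x : Site X) :
    val (delta X G h t) x =
      G.cast (by omega) (t (x.1 - 1) (boundary X x.1 (x.1 - 1) (Finsupp.single x.2 1))) -
      (p.negOnePow : ℤ) • G.d (x.1 - q) (G.cast (by omega) (val t x)) := rfl

theorem val_dualDelta (h : q + 1 = p) (γ : DualPMap X G p) (x : Site X) :
    val (dualDelta X G h γ) x =
      G.dualCast (by omega) (γ (x.1 + 1) (coboundary X x.1 (x.1 + 1) (Finsupp.single x.2 1))) -
      (q.negOnePow : ℤ) • G.dualCast (by omega) (G.dualD (x.1 - p) (val γ x)) := rfl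

theorem delta_add (h : p + 1 = q) (s t : PMap X G p) :
    delta X G h (s + t) = delta X G h s + delta X G h t := by
  funext n
  refine AddMonoidHom.ext fun c => ?_
  simp only [delta, Pi.add_apply, AddMonoidHom.sub_apply, AddMonoidHom.comp_apply,
    AddMonoidHom.smul_apply, AddMonoidHom.add_apply, map_add, smul_add]
  abel

theorem dualDelta_apply (h : q + 1 = p) (γ : DualPMap X G p) (n : ℤ) (c : Chain X n) :
    dualDelta X G h γ n c =
      G.dualCast (by omega) (γ (n + 1) (coboundary X n (n + 1) c)) -
      (q.negOnePow : ℤ) • G.dualCast (by omega) (G.dualD (n - p) (γ n c)) := rfl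

theorem dualDelta_add (h : q + 1 = p) (γ η : DualPMap X G p) :
    dualDelta X G h (γ + η) = dualDelta X G h γ + dualDelta X G h η := by
  funext n
  refine AddMonoidHom.ext fun c => ?_
  simp only [dualDelta_apply, Pi.add_apply, AddMonoidHom.add_apply, map_add, zsmul_add]
  abel

/-- Each side is a single character value. If x has one dimension more than y, both sides come from
the incidence number ε_{x,y}; if x = y, from the coefficient boundary with the common sign -(-1)^q;
otherwise both are 1. -/
theorem pairing_dualDelta_single (h : q + 1 = p) {γ : DualPMap X G p} {u : PMap X G q}
    {x y : Site X} (hγ : ∀ z, z ≠ x → val γ z = 0) (hu : ∀ z, z ≠ y → val u z = 0) :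
    pairing (dualDelta X G h γ) u = pairing γ (delta X G h u) := by
  rw [pairing_eq_of_right hu, pairing_eq_of_left hγ, val_dualDelta, val_delta]
  by_cases hd : x.1 = y.1 + 1
  · obtain ⟨m, x⟩ := x
    obtain ⟨n, y⟩ := y
    obtain rfl : m = n + 1 := hd
    have hxy : (⟨n, y⟩ : Site X) ≠ ⟨n + 1, x⟩ := fun he => by
      have := congrArg Sigma.fst he
      simp at this
    -- The degree n + 1 - 1 is replaced by a variable k so that k = n can be substituted in the
    -- dependent types.
    have key : ∀ (k : ℤ) (hk : k = n) (hk' : k - q = n + 1 - p),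
        G.cast hk' (u k (boundary X (n + 1) k (Finsupp.single x 1))) =
          incidence X x y • G.cast (by dsimp only; omega) (val u ⟨n, y⟩) := by
      rintro k rfl hk'
      rw [apply_of_single hu, boundary_single_apply, map_zsmul]
    rw [hγ _ hxy, hu _ hxy.symm, key _ (by dsimp only; omega), apply_of_single hγ,
      coboundary_single_apply]
    simp only [map_zero, smul_zero, zsmul_zero, sub_zero]
    rw [map_zsmul, AddChar.map_zsmul_eq_zpow]
    erw [AddChar.zsmul_apply]
    rw [AlgebraicData.dualCast_apply_cast]
  · by_cases hxy : x = y
    · subst hxy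
      rw [apply_eq_zero_of_ne hγ (by omega), apply_eq_zero_of_ne hu (by omega)]
      simp only [map_zero, zero_sub]
      rw [AddChar.map_neg_eq_inv, AddChar.map_zsmul_eq_zpow, AddChar.neg_apply']
      erw [AddChar.zsmul_apply]
      rw [AlgebraicData.dualCast_apply_cast _ _ (by omega)]
      rfl
    · rw [apply_eq_zero_of_ne hγ hd, apply_eq_zero_of_ne hu (by omega), hγ y (Ne.symm hxy),
        hu x hxy]
      simp

/-- Both sides are multiplicative in u and in γ, which reduces the claim to one-simplex arguments.
-/
theorem pairing_dualDelta (h : q + 1 = p) (γ : DualPMap₀ X G p) (u : PMap₀ X G q) :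
    pairing (dualDelta X G h γ.1) u.1 = pairing γ.1 (delta X G h u.1) := by
  induction u using compactlySupported_induction with
  | zero =>
    have e : delta X G h (0 : PMap X G q) = 0 := by
      have := delta_add h (0 : PMap X G q) 0
      simpa using this
    have h1 := pairing_zero_right
      (⟨dualDelta X G h γ.1, dualDelta_mem X G h γ.1 γ.2⟩ : DualPMap₀ X G q)
    change pairing (dualDelta X G h γ.1) 0 = pairing γ.1 (delta X G h 0)
    rw [e, h1, pairing_zero_right]
  | add s t hs ht =>
    have h1 := pairing_add_right
      (⟨dualDelta X G h γ.1, dualDelta_mem X G h γ.1 γ.2⟩ : DualPMap₀ X G q) s.1 t.1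
    rw [AddSubgroup.coe_add, delta_add, pairing_add_right, ← hs, ← ht, h1]
  | single y u hu =>
    induction γ using compactlySupported_induction with
    | zero =>
      have e : dualDelta X G h (0 : DualPMap X G p) = 0 := by
        have := dualDelta_add h (0 : DualPMap X G p) 0
        simpa using this
      change pairing (dualDelta X G h 0) u.1 = pairing (0 : DualPMap₀ X G p).1 (delta X G h u.1)
      rw [e, pairing_zero_left]
      exact pairing_zero_left (p := q) u.1
    | add γ η hγ hη =>
      have h1 := pairing_add_left
        (⟨dualDelta X G h γ.1, dualDelta_mem X G h γ.1 γ.2⟩ : DualPMap₀ X G q)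
        ⟨dualDelta X G h η.1, dualDelta_mem X G h η.1 η.2⟩ u.1
      rw [pairing_add_left, ← hγ, ← hη, ← h1, AddSubgroup.coe_add, dualDelta_add]
      rfl
    | single x γ hγ => exact pairing_dualDelta_single h hγ hu

/-- The coboundaries `δ_1 γ` pair trivially with the coboundaries `δ^{-1} t`. -/
theorem pairing_dualDelta_delta {r : ℤ} (h : q + 1 = p) (h' : r + 1 = q) (γ : DualPMap₀ X G p)
    (t : PMap₀ X G r) : pairing (dualDelta X G h γ.1) (delta X G h' t.1) = 1 := by
  rw [pairing_dualDelta h γ ⟨_, delta_mem X G h' t.1 t.2⟩, delta_delta, pairing_zero_right]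

end Pairing

end

section

/-! ### Density and equality of states -/

section Closure

variable {A : Type*} [CStarAlgebra A]

/-- Under these conditions the span of M is itself a *-subalgebra. -/
theorem mem_span_of_mem_adjoin {M S : Set A} (one : 1 ∈ Submodule.span ℂ M)
    (mul : ∀ a ∈ M, ∀ b ∈ M, a * b ∈ Submodule.span ℂ M)
    (star_mem : ∀ a ∈ M, star a ∈ Submodule.span ℂ M)
    (hS : S ⊆ Submodule.span ℂ M) {a : A} (ha : a ∈ StarAlgebra.adjoin ℂ S) :
    a ∈ Submodule.span ℂ M := by
  induction ha using StarAlgebra.adjoin_induction with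
  | mem a ha => exact hS ha
  | algebraMap c => rw [Algebra.algebraMap_eq_smul_one]; exact Submodule.smul_mem _ _ one
  | add a b _ _ ha hb => exact add_mem ha hb
  | mul a b _ _ ha hb =>
    have h : Submodule.span ℂ M * Submodule.span ℂ M ≤ Submodule.span ℂ M := by
      rw [Submodule.span_mul_span, Submodule.span_le]
      rintro _ ⟨a, ha, b, hb, rfl⟩
      exact mul a ha b hb
    exact h (Submodule.mul_mem_mul ha hb)
  | star a h ha =>
    clear h
    induction ha using Submodule.span_induction with
    | mem a ha => exact star_mem a ha
    | zero => rw [star_zero]; exact zero_mem _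
    | add a b _ _ ha hb => rw [star_add]; exact add_mem ha hb
    | smul c a _ ha => rw [star_smul]; exact Submodule.smul_mem _ _ ha

/-- States are continuous, so their equality locus is a closed subspace. Density is assumed in the
ambient algebra and transferred to the subspace topology of S. -/
theorem State.ext_of_span {S : StarSubalgebra ℂ A} (hS : IsClosed (S : Set A)) {M : Set A}
    (hM : M ⊆ S) (hd : (S : Set A) ⊆ closure (Submodule.span ℂ M)) {ω ω' : State S}
    (h : ∀ (a : A) (_ : a ∈ M) (h : a ∈ S), ω ⟨a, h⟩ = ω' ⟨a, h⟩) : ω = ω' := by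
  have : IsClosed (S : Set A) := hS
  let E : Submodule ℂ S := LinearMap.eqLocus ω.toLinearMap ω'.toLinearMap
  have hE : IsClosed (E : Set S) := isClosed_eq ω.continuous ω'.continuous
  have hle : Submodule.span ℂ M ≤ E.map S.toSubalgebra.toSubmodule.subtype :=
    Submodule.span_le.mpr fun a ha => ⟨⟨a, hM ha⟩, h a ha (hM ha), rfl⟩
  refine State.ext fun a => ?_
  have ha : a ∈ closure (E : Set S) := closure_subtype.mpr
    (closure_mono (show (Submodule.span ℂ M : Set A) ⊆ Subtype.val '' (E : Set S) from hle)
      (hd a.2))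
  rw [hE.closure_eq] at ha
  exact ha

end Closure

variable {V : Type u} [LinearOrder V] {N L : ℕ} {X : GeometricData V N L} {G : AlgebraicData.{v} N}

/-! ### Weyl relations on the Hilbert space -/

section Kets

theorem inner_ket_left (c : Conf X G) (f : Hilb X G) : inner ℂ (ket c) f = f c := by
  classical
  rw [ket, lp.inner_single_left]
  simp

theorem hilb_ext {f g : Hilb X G} (h : ∀ c : Conf X G, inner ℂ (ket c) f = inner ℂ (ket c) g) :
    f = g := by
  refine lp.ext (funext fun c => ?_)
  rw [← inner_ket_left, ← inner_ket_left, h]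

theorem op_ext {S T : Hilb X G →L[ℂ] Hilb X G} (h : ∀ c : Conf X G, S (ket c) = T (ket c)) :
    S = T := by
  classical
  refine lp.ext_continuousLinearMap (by norm_num) fun c => ?_
  ext
  have := h c
  simp only [ket] at this
  simpa using congrArg (fun f : Hilb X G => f _) this

theorem shiftOp_mul (s t : Conf X G) : shiftOp s * shiftOp t = shiftOp (s + t) :=
  op_ext fun c => by
    rw [mul_apply_eq_comp, shiftOp_ket, shiftOp_ket, shiftOp_ket, add_assoc]

theorem shiftOp_zero : shiftOp (0 : Conf X G) = 1 :=
  op_ext fun c => by rw [shiftOp_ket, zero_add, one_apply_eq_self]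

theorem clockOp_mul (γ η : Repr X G) : clockOp γ * clockOp η = clockOp (γ + η) :=
  op_ext fun c => by
    rw [mul_apply_eq_comp, clockOp_ket, map_smul, clockOp_ket, clockOp_ket, smul_smul,
      pairing_add_left, Circle.coe_mul, mul_comm]

theorem clockOp_zero : clockOp (0 : Repr X G) = 1 :=
  op_ext fun c => by
    rw [clockOp_ket, pairing_zero_left, Circle.coe_one, one_smul, one_apply_eq_self]

theorem clockOp_mul_shiftOp (γ : Repr X G) (t : Conf X G) :
    clockOp γ * shiftOp t = (pairing γ.1 t.1 : ℂ) • (shiftOp t * clockOp γ) :=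
  op_ext fun c => by
    rw [mul_apply_eq_comp, smul_apply,
      mul_apply_eq_comp, shiftOp_ket, clockOp_ket, clockOp_ket, map_smul, shiftOp_ket,
      smul_smul, AddSubgroup.coe_add, pairing_add_right, Circle.coe_mul]

/-- An isometry with a right inverse is unitary. -/
theorem star_eq_of_isometry {S T : Hilb X G →L[ℂ] Hilb X G} (hS : ∀ f, ‖S f‖ = ‖f‖)
    (h : S * T = 1) : star S = T := by
  have h1 : star S * S = 1 := (ContinuousLinearMap.norm_map_iff_adjoint_comp_self S).mp hS
  calc star S = star S * (S * T) := by rw [h, mul_one]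
    _ = T := by rw [← mul_assoc, h1, one_mul]

theorem star_shiftOp (t : Conf X G) : star (shiftOp t) = shiftOp (-t) :=
  star_eq_of_isometry (fun f => LinearIsometry.norm_map _ f)
    (by rw [shiftOp_mul, add_neg_cancel, shiftOp_zero])

theorem star_clockOp (γ : Repr X G) : star (clockOp γ) = clockOp (-γ) :=
  star_eq_of_isometry (fun f => LinearIsometry.norm_map _ f)
    (by rw [clockOp_mul, add_neg_cancel, clockOp_zero])

end Kets

/-! ### Local operators are combinations of Weyl monomials -/

section LocalOperators

open Classical in
-- Orthogonality of characters. If u is nonzero at a simplex of Λ, some character of the coefficient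
-- group there detects it, so evaluation at u is a nontrivial character.
theorem sum_pairing_supportedIn (Λ : Finset (Site X)) [Fintype (supportedIn (X := X)
    (fun n => G.dual (n - 0)) Λ)] (u : Conf X G) :
    ∑ γ : supportedIn (X := X) (fun n => G.dual (n - 0)) Λ, (pairing γ.1.1 u.1 : ℂ) =
      if ∀ x ∈ Λ, val u.1 x = 0 then
        (Fintype.card (supportedIn (X := X) (fun n => G.dual (n - 0)) Λ) : ℂ) else 0 := by
  let ψ : AddChar (supportedIn (X := X) (fun n => G.dual (n - 0)) Λ) ℂ :=
    Circle.coeHom.compAddChar ((evalChar u.1).compAddMonoidHom (AddSubgroup.subtype _))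
  have h := AddChar.sum_eq_ite ψ
  have hψ : ψ = 0 ↔ ∀ x ∈ Λ, val u.1 x = 0 := by
    constructor
    · intro h0 x hx
      by_contra hne
      obtain ⟨χ, hχ⟩ := AddChar.exists_apply_ne_zero.mpr hne
      let α : G.dual (x.1 - 0) := AddChar.circleEquivComplex.symm χ
      have hα : (α (val u.1 x) : ℂ) = χ (val u.1 x) :=
        DFunLike.congr_fun (AddChar.circleEquivComplex.apply_symm_apply χ) _
      have hmem : (dualLocalized X G x α : Repr X G) ∈
          supportedIn (X := X) (fun n => G.dual (n - 0)) Λ := fun y hy =>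
        val_dualLocalized_of_ne (x := x) (fun he => hy (by rwa [he])) α
      have h1 : (pairing (dualLocalized X G x α : Repr X G).1 u.1 : ℂ) = 1 :=
        DFunLike.congr_fun h0 (⟨dualLocalized X G x α, hmem⟩ :
          supportedIn (X := X) (fun n => G.dual (n - 0)) Λ)
      rw [pairing_eq_of_left (x := x) (fun y hy => val_dualLocalized_of_ne hy α),
        val_dualLocalized_self, hα] at h1
      exact hχ h1
    · intro h0
      refine DFunLike.ext _ _ fun γ => ?_
      change (pairing γ.1.1 u.1 : ℂ) = 1
      rw [pairing, finprod_eq_one_of_forall_eq_one, Circle.coe_one]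
      intro x
      by_cases hx : x ∈ Λ
      · rw [h0 x hx, AddChar.map_zero_eq_one]
      · rw [γ.2 x hx, AddChar.zero_apply]
  simp only [hψ] at h
  exact h

/-- The projection onto the configurations that agree with `r` on `Λ`. -/
def diagOp (Λ : Finset (Site X)) (r : Conf X G) : Hilb X G →L[ℂ] Hilb X G :=
  (Nat.card (supportedIn (X := X) (fun n => G.dual (n - 0)) Λ) : ℂ)⁻¹ •
    ∑ᶠ γ : supportedIn (X := X) (fun n => G.dual (n - 0)) Λ,
      (pairing γ.1.1 (-r).1 : ℂ) • clockOp γ.1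

open Classical in
-- Fourier inversion: averaging γ(c - r) over the dual maps γ supported in Λ gives the indicator of
-- c = r on Λ.
theorem diagOp_ket (Λ : Finset (Site X)) (r c : Conf X G) :
    diagOp Λ r (ket c) = if ∀ x ∈ Λ, val (c - r).1 x = 0 then ket c else 0 := by
  have := Fintype.ofFinite (supportedIn (X := X) (fun n => G.dual (n - 0)) Λ)
  rw [diagOp, finsum_eq_sum_of_fintype, smul_apply,
    sum_apply]
  have e : ∀ γ : supportedIn (X := X) (fun n => G.dual (n - 0)) Λ,
      ((pairing γ.1.1 (-r).1 : ℂ) • clockOp γ.1) (ket c) = (pairing γ.1.1 (c - r).1 : ℂ) • ket c :=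
    fun γ => by
      rw [smul_apply, clockOp_ket, smul_smul, ← Circle.coe_mul,
        ← pairing_add_right, ← AddSubgroup.coe_add, neg_add_eq_sub]
  simp only [e]
  rw [← Finset.sum_smul, sum_pairing_supportedIn, smul_smul, Nat.card_eq_fintype_card]
  split_ifs
  · rw [inv_mul_cancel₀ (Nat.cast_ne_zero.mpr Fintype.card_ne_zero), one_smul]
  · rw [mul_zero, zero_smul]

variable (X G) in
/-- The Weyl monomials. -/
def weylMonomials : Set (Hilb X G →L[ℂ] Hilb X G) :=
  Set.range fun a : Conf X G × Repr X G => shiftOp a.1 * clockOp a.2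

theorem shiftOp_mul_diagOp_mem (Λ : Finset (Site X)) (t r : Conf X G) :
    shiftOp t * diagOp Λ r ∈ Submodule.span ℂ (weylMonomials X G) := by
  have := Fintype.ofFinite (supportedIn (X := X) (fun n => G.dual (n - 0)) Λ)
  rw [diagOp, finsum_eq_sum_of_fintype, mul_smul_comm, Finset.mul_sum]
  refine Submodule.smul_mem _ _ (Submodule.sum_mem _ fun γ _ => ?_)
  rw [mul_smul_comm]
  exact Submodule.smul_mem _ _ (Submodule.subset_span ⟨(t, γ.1), rfl⟩)

/-- The operators P_d times the projection onto r are the matrix units of 𝔄_Λ, and T is expanded in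
them with its matrix elements as coefficients. -/
theorem IsSupportedOn.mem_span {Λ : Finset (Site X)} {T : Hilb X G →L[ℂ] Hilb X G}
    (hT : IsSupportedOn Λ T) : T ∈ Submodule.span ℂ (weylMonomials X G) := by
  classical
  have := Fintype.ofFinite (supportedIn (X := X) (fun n => G.grp (n - 0)) Λ)
  have hsum : T = ∑ d : supportedIn (X := X) (fun n => G.grp (n - 0)) Λ,
      ∑ r : supportedIn (X := X) (fun n => G.grp (n - 0)) Λ,
        (inner ℂ (ket (r.1 + d.1)) (T (ket r.1)) : ℂ) • (shiftOp d.1 * diagOp Λ r.1) := by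
    refine op_ext fun c => hilb_ext fun c' => ?_
    -- The part of c inside Λ labels the only projection that does not annihilate |c⟩.
    let r₀ : supportedIn (X := X) (fun n => G.grp (n - 0)) Λ := ⟨cutoff Λ c.1, cutoff_mem Λ c.1⟩
    have hs : ∀ x ∈ Λ, val (c - r₀.1).1 x = 0 := fun x hx => by
      change val (c.1 - r₀.1.1) x = 0
      rw [val_sub, val_cutoff_of_mem _ hx, sub_self]
    have hr : ∀ r : supportedIn (X := X) (fun n => G.grp (n - 0)) Λ,
        (∀ x ∈ Λ, val (c - r.1).1 x = 0) ↔ r = r₀ := by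
      intro r
      refine ⟨fun h => Subtype.ext (Subtype.ext (family_ext fun x => ?_)), fun h => h ▸ hs⟩
      by_cases hx : x ∈ Λ
      · have h1 := h x hx
        change val (c.1 - r.1.1) x = 0 at h1
        rw [val_sub, sub_eq_zero] at h1
        rw [← h1, val_cutoff_of_mem _ hx]
      · rw [r.2 x hx, r₀.2 x hx]
    simp only [sum_apply, smul_apply,
      mul_apply_eq_comp, diagOp_ket, hr, apply_ite, map_zero, smul_zero, shiftOp_ket,
      Finset.sum_ite_eq', Finset.mem_univ, if_true, inner_sum, inner_smul_right, inner_ket]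
    -- If c' and c agree off Λ, only d = c' - c contributes, and translating by the part of c off Λ
    -- identifies the matrix elements. Otherwise both sides vanish.
    by_cases hc : c' - c ∈ supportedIn (X := X) (fun n => G.grp (n - 0)) Λ
    · rw [Finset.sum_eq_single_of_mem (⟨c' - c, hc⟩ : supportedIn _ Λ) (Finset.mem_univ _)]
      · simp only [sub_add_cancel, if_true, mul_one]
        have h := hT.2 (r₀.1 + (c' - c)) r₀.1 (c - r₀.1) hs
        rw [← h]
        congr 2
        · abel_nf
        · abel_nf
      · intro d _ hd
        rw [if_neg, mul_zero]
        rintro rfl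
        exact hd (Subtype.ext (by simp))
    · rw [Finset.sum_eq_zero]
      · refine hT.1 _ _ ?_
        by_contra hcon
        push Not at hcon
        refine hc fun x hx => ?_
        change val (c'.1 - c.1) x = 0
        rw [val_sub, hcon x hx, sub_self]
      · intro d _
        rw [if_neg, mul_zero]
        rintro rfl
        exact hc (by simp)
  rw [hsum]
  exact Submodule.sum_mem _ fun d _ => Submodule.sum_mem _ fun r _ =>
    Submodule.smul_mem _ _ (shiftOp_mul_diagOp_mem Λ d.1 r.1)

/-- By the Weyl relation, products and adjoints of monomials are scalar multiples of monomials, so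
their span contains the *-algebra generated by the local operators. -/
theorem quasiLocal_subset_closure :
    (quasiLocal X G : Set (Hilb X G →L[ℂ] Hilb X G)) ⊆
      closure (Submodule.span ℂ (weylMonomials X G)) := by
  refine closure_mono fun T hT => mem_span_of_mem_adjoin (M := weylMonomials X G) ?_ ?_ ?_ ?_ hT
  · exact Submodule.subset_span ⟨(0, 0), by
      change shiftOp 0 * clockOp 0 = 1
      rw [shiftOp_zero, clockOp_zero, mul_one]⟩
  · rintro _ ⟨⟨s, γ⟩, rfl⟩ _ ⟨⟨t, η⟩, rfl⟩
    have e : shiftOp s * clockOp γ * (shiftOp t * clockOp η) =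
        (pairing γ.1 t.1 : ℂ) • (shiftOp (s + t) * clockOp (γ + η)) := by
      rw [mul_assoc, ← mul_assoc (clockOp γ), clockOp_mul_shiftOp, smul_mul_assoc, mul_smul_comm,
        ← shiftOp_mul, ← clockOp_mul, mul_assoc, mul_assoc]
    dsimp only
    rw [e]
    exact Submodule.smul_mem _ _ (Submodule.subset_span ⟨(s + t, γ + η), rfl⟩)
  · rintro _ ⟨⟨s, γ⟩, rfl⟩
    dsimp only
    rw [star_mul, star_shiftOp, star_clockOp, clockOp_mul_shiftOp]
    exact Submodule.smul_mem _ _ (Submodule.subset_span ⟨(-s, -γ), rfl⟩)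
  · rintro T ⟨Λ, hΛ⟩
    exact hΛ.mem_span

end LocalOperators

/-! ### Weyl operators inside the quasi-local algebra -/

section Weyl

theorem shift_mul (s t : Conf X G) : shift s * shift t = shift (s + t) :=
  Subtype.ext (shiftOp_mul s t)

theorem shift_zero : shift (0 : Conf X G) = 1 := Subtype.ext shiftOp_zero

theorem star_shift (t : Conf X G) : star (shift t) = shift (-t) := Subtype.ext (star_shiftOp t)

theorem clock_mul (γ η : Repr X G) : clock γ * clock η = clock (γ + η) :=
  Subtype.ext (clockOp_mul γ η)

theorem clock_zero : clock (0 : Repr X G) = 1 := Subtype.ext clockOp_zero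

theorem star_clock (γ : Repr X G) : star (clock γ) = clock (-γ) := Subtype.ext (star_clockOp γ)

theorem clock_mul_shift (γ : Repr X G) (t : Conf X G) :
    clock γ * shift t = (pairing γ.1 t.1 : ℂ) • (shift t * clock γ) :=
  Subtype.ext (clockOp_mul_shiftOp γ t)

theorem shift_mem_unitary (t : Conf X G) : shift t ∈ unitary (QL X G) := by
  rw [Unitary.mem_iff, star_shift, shift_mul, shift_mul, neg_add_cancel, add_neg_cancel, shift_zero]
  exact ⟨rfl, rfl⟩

theorem clock_mem_unitary (γ : Repr X G) : clock γ ∈ unitary (QL X G) := by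
  rw [Unitary.mem_iff, star_clock, clock_mul, clock_mul, neg_add_cancel, add_neg_cancel, clock_zero]
  exact ⟨rfl, rfl⟩

theorem isClosed_quasiLocal :
    IsClosed (quasiLocal X G : Set (Hilb X G →L[ℂ] Hilb X G)) :=
  StarSubalgebra.isClosed_topologicalClosure _

instance : CStarAlgebra (QL X G) :=
  StarSubalgebra.cstarAlgebra (h_closed := isClosed_quasiLocal) (quasiLocal X G)

theorem State.ext_of_weyl {ω ω' : State (QL X G)}
    (h : ∀ t γ, ω (shift t * clock γ) = ω' (shift t * clock γ)) : ω = ω' := by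
  refine State.ext_of_span isClosed_quasiLocal (M := weylMonomials X G) ?_
    quasiLocal_subset_closure ?_
  · rintro _ ⟨⟨t, γ⟩, rfl⟩
    exact (shift t * clock γ).2
  · rintro _ ⟨⟨t, γ⟩, rfl⟩ _
    exact h t γ

end Weyl

end

section

/-! ### Limits of states, and positivity of commutators with projections -/

section Limits

variable {A : Type*} [CStarAlgebra A]

open Filter Topology in
/-- A net of states has a limit point among the states. -/
theorem State.exists_limit {ι : Type*} [Preorder ι] [IsDirectedOrder ι] [Nonempty ι]
    (ω : ι → State A) :
    ∃ ω₀ : State A, ∀ a c, (∀ᶠ i in atTop, ω i a = c) → ω₀ a = c := by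
  -- Weak* compactness by hand: the values at a stay in a compact disc of radius ‖a‖, so they
  -- converge along an ultrafilter finer than `atTop`.
  let U : Ultrafilter ι := Ultrafilter.of atTop
  have hlim : ∀ a, ∃ l, Tendsto (fun i => ω i a) U (𝓝 l) := by
    intro a
    obtain ⟨l, -, hl⟩ := (isCompact_closedBall (0 : ℂ) ‖a‖).ultrafilter_le_nhds
      (U.map fun i => ω i a) (by
        rw [le_principal_iff]
        change ∀ᶠ i in (U : Filter ι), ω i a ∈ Metric.closedBall 0 ‖a‖
        exact Eventually.of_forall fun i => by simpa using (ω i).norm_map_le a)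
    exact ⟨l, hl⟩
  choose f hf using hlim
  have hc : ∀ a c, (∀ᶠ i in atTop, ω i a = c) → f a = c := fun a c h =>
    tendsto_nhds_unique (hf a) (tendsto_const_nhds.congr'
      ((Ultrafilter.of_le atTop) (h.mono fun i hi => hi.symm)))
  refine ⟨⟨⟨⟨f, fun a b => ?_⟩, fun c a => ?_⟩, ?_, fun a => ?_⟩, hc⟩
  · refine tendsto_nhds_unique (hf (a + b)) (((hf a).add (hf b)).congr fun i => ?_)
    rw [map_add]
  · refine tendsto_nhds_unique (hf (c • a)) (((hf a).const_smul c).congr fun i => ?_)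
    rw [map_smul]
  · exact hc 1 1 (Eventually.of_forall fun i => (ω i).map_one)
  · exact ge_of_tendsto' (hf (star a * a)) fun i => (ω i).nonneg a

/-- Since ω annihilates the left ideal generated by p - 1, the expression equals ω(a*(1 - p)a), that
is, ω at ((1 - p)a)*((1 - p)a). -/
theorem State.nonneg_commutator (ω : State A) {p : A} (hs : star p = p) (hp : p * p = p)
    (h : ω p = 1) (a : A) : 0 ≤ ω (star a * (a * p - p * a)) := by
  have h0 : ω (star (p - 1) * (p - 1)) = 0 := by
    have : star (p - 1) * (p - 1) = 1 - p := by
      rw [star_sub, star_one, hs, mul_sub, sub_mul, hp]; simp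
    rw [this, map_sub, ω.map_one, h, sub_self]
  have h1 := ω.map_mul_eq_zero h0 (star a * a)
  have h2 := ω.nonneg ((1 - p) * a)
  have h3 : star ((1 - p) * a) * ((1 - p) * a) =
      star a * (a * p - p * a) - star a * a * (p - 1) := by
    have : (1 - p) * (1 - p) = 1 - p := by
      rw [mul_sub, mul_one, sub_mul, one_mul, hp, sub_self, sub_zero]
    rw [star_mul, star_sub, star_one, hs, mul_assoc, ← mul_assoc (1 - p), this]
    noncomm_ring
  rwa [h3, map_sub, h1, sub_zero] at h2

theorem State.nonneg_commutator_sum (ω : State A) {ι κ : Type*} (s : Finset ι) (t : Finset κ)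
    {p : ι → A} {q : κ → A} (hps : ∀ i, star (p i) = p i) (hp : ∀ i, p i * p i = p i)
    (hωp : ∀ i, ω (p i) = 1) (hqs : ∀ i, star (q i) = q i) (hq : ∀ i, q i * q i = q i)
    (hωq : ∀ i, ω (q i) = 1) (a : A) :
    0 ≤ ω (star a * (-(∑ i ∈ s, p i + ∑ i ∈ t, q i) * a - a * -(∑ i ∈ s, p i + ∑ i ∈ t, q i))) := by
  have e : star a * (-(∑ i ∈ s, p i + ∑ i ∈ t, q i) * a - a * -(∑ i ∈ s, p i + ∑ i ∈ t, q i)) =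
      (∑ i ∈ s, star a * (a * p i - p i * a)) + ∑ i ∈ t, star a * (a * q i - q i * a) := by
    rw [← Finset.mul_sum, ← Finset.mul_sum, ← mul_add, Finset.sum_sub_distrib,
      Finset.sum_sub_distrib, ← Finset.mul_sum, ← Finset.mul_sum, ← Finset.sum_mul,
      ← Finset.sum_mul]
    noncomm_ring
  rw [e, map_add, map_sum, map_sum]
  exact add_nonneg
    (Finset.sum_nonneg fun i _ => ω.nonneg_commutator (hps i) (hp i) (hωp i) a)
    (Finset.sum_nonneg fun i _ => ω.nonneg_commutator (hqs i) (hq i) (hωq i) a)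

end Limits

variable {V : Type u} [LinearOrder V] {N L : ℕ} {X : GeometricData V N L} {G : AlgebraicData.{v} N}

/-! ### Commutation relations of the gauge operators -/

section Gauge

variable (X G) in
/-- The coboundary `δ^p` on compactly supported maps. -/
def deltaHom {p q : ℤ} (h : p + 1 = q) : PMap₀ X G p →+ PMap₀ X G q :=
  AddMonoidHom.mk' (fun t => ⟨delta X G h t.1, delta_mem X G h t.1 t.2⟩)
    fun s t => Subtype.ext (delta_add h s.1 t.1)

variable (X G) in
/-- The coboundary `δ_p` on compactly supported dual maps. -/
def dualDeltaHom {p q : ℤ} (h : q + 1 = p) : DualPMap₀ X G p →+ DualPMap₀ X G q :=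
  AddMonoidHom.mk' (fun γ => ⟨dualDelta X G h γ.1, dualDelta_mem X G h γ.1 γ.2⟩)
    fun γ η => Subtype.ext (dualDelta_add h γ.1 η.1)

theorem gaugeA_eq (t : PMap₀ X G (-1)) : gaugeA t = shift (deltaHom X G (by norm_num) t) := rfl

theorem gaugeB_eq (γ : DualPMap₀ X G 1) : gaugeB γ = clock (dualDeltaHom X G (by norm_num) γ) := rfl

theorem gaugeA_add (s t : PMap₀ X G (-1)) : gaugeA (s + t) = gaugeA s * gaugeA t := by
  rw [gaugeA_eq, map_add, ← shift_mul]; rfl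

theorem gaugeA_zero : gaugeA (0 : PMap₀ X G (-1)) = 1 := by
  rw [gaugeA_eq, map_zero, shift_zero]

theorem star_gaugeA (t : PMap₀ X G (-1)) : star (gaugeA t) = gaugeA (-t) := by
  rw [gaugeA_eq, gaugeA_eq, map_neg, star_shift]

theorem gaugeB_add (γ η : DualPMap₀ X G 1) : gaugeB (γ + η) = gaugeB γ * gaugeB η := by
  rw [gaugeB_eq, map_add, ← clock_mul]; rfl

theorem gaugeB_zero : gaugeB (0 : DualPMap₀ X G 1) = 1 := by
  rw [gaugeB_eq, map_zero, clock_zero]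

theorem star_gaugeB (γ : DualPMap₀ X G 1) : star (gaugeB γ) = gaugeB (-γ) := by
  rw [gaugeB_eq, gaugeB_eq, map_neg, star_clock]

theorem commute_gaugeA_gaugeA (s t : PMap₀ X G (-1)) : Commute (gaugeA s) (gaugeA t) := by
  rw [Commute, SemiconjBy, ← gaugeA_add, ← gaugeA_add, add_comm]

theorem commute_gaugeB_gaugeB (γ η : DualPMap₀ X G 1) : Commute (gaugeB γ) (gaugeB η) := by
  rw [Commute, SemiconjBy, ← gaugeB_add, ← gaugeB_add, add_comm]

/-- The Weyl phase is the pairing of δ_1 γ with δ⁻¹t, which is trivial by transposition and δ⁰δ⁻¹ =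
0. -/
theorem commute_gaugeB_gaugeA (γ : DualPMap₀ X G 1) (t : PMap₀ X G (-1)) :
    Commute (gaugeB γ) (gaugeA t) := by
  rw [Commute, SemiconjBy, gaugeA_eq, gaugeB_eq, clock_mul_shift]
  have h : pairing (dualDeltaHom X G (by norm_num : (0 : ℤ) + 1 = 1) γ).1
      (deltaHom X G (by norm_num : (-1 : ℤ) + 1 = 0) t).1 = 1 :=
    pairing_dualDelta_delta (by norm_num) (by norm_num) γ t
  rw [h, Circle.coe_one, one_smul]

/-- Transposition moves the phase onto δ_0 γ, whose finite support controls which one-simplex A_t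
can fail to commute with Q_γ. -/
theorem clock_mul_gaugeA (γ : Repr X G) (t : PMap₀ X G (-1)) : clock γ * gaugeA t =
    (pairing (dualDelta X G (by norm_num : (-1 : ℤ) + 1 = 0) γ.1) t.1 : ℂ) •
      (gaugeA t * clock γ) := by
  rw [gaugeA_eq, clock_mul_shift, pairing_dualDelta]; rfl

theorem gaugeB_mul_shift (γ : DualPMap₀ X G 1) (t : Conf X G) : gaugeB γ * shift t =
    (pairing γ.1 (delta X G (by norm_num : (0 : ℤ) + 1 = 1) t.1) : ℂ) • (shift t * gaugeB γ) := by
  rw [gaugeB_eq, clock_mul_shift, ← pairing_dualDelta]; rfl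

theorem weyl_mul_gaugeA (s : Conf X G) (γ : Repr X G) (t : PMap₀ X G (-1)) :
    shift s * clock γ * gaugeA t =
    (pairing (dualDelta X G (by norm_num : (-1 : ℤ) + 1 = 0) γ.1) t.1 : ℂ) •
      (gaugeA t * (shift s * clock γ)) := by
  have h : shift s * gaugeA t = gaugeA t * shift s := by
    rw [gaugeA_eq, shift_mul, shift_mul, add_comm]
  rw [mul_assoc, clock_mul_gaugeA, mul_smul_comm, ← mul_assoc, h, mul_assoc]

theorem gaugeB_mul_weyl (γ : DualPMap₀ X G 1) (t : Conf X G) (η : Repr X G) :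
    gaugeB γ * (shift t * clock η) =
    (pairing γ.1 (delta X G (by norm_num : (0 : ℤ) + 1 = 1) t.1) : ℂ) •
      (shift t * clock η * gaugeB γ) := by
  have h : gaugeB γ * clock η = clock η * gaugeB γ := by
    rw [gaugeB_eq, clock_mul, clock_mul, add_comm]
  rw [← mul_assoc, gaugeB_mul_shift, smul_mul_assoc, mul_assoc, h, mul_assoc]

end Gauge

/-! ### The core, its commutant and the seed state -/

section Core

theorem isClosed_core : IsClosed (core X G : Set (QL X G)) :=
  StarSubalgebra.isClosed_topologicalClosure _

theorem isClosed_centralizer {A : Type*} [CStarAlgebra A] (s : Set A) :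
    IsClosed (StarSubalgebra.centralizer ℂ s : Set A) := by
  rw [StarSubalgebra.coe_centralizer]
  exact Set.isClosed_centralizer _

theorem isClosed_commutant : IsClosed (commutant X G : Set (QL X G)) := isClosed_centralizer _

/-- It suffices to test generators: the centralizer of {a, a*} is a closed *-subalgebra, and the
adjoint of a generator is again a generator. -/
theorem mem_commutant_iff {a : QL X G} : a ∈ commutant X G ↔
    (∀ t, Commute (gaugeA t) a) ∧ ∀ γ, Commute (gaugeB γ) a := by
  refine ⟨fun h => ⟨fun t => ?_, fun γ => ?_⟩, fun h => ?_⟩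
  · exact ((StarSubalgebra.mem_centralizer_iff ℂ).mp h _ (gaugeA_mem_core t)).1
  · exact ((StarSubalgebra.mem_centralizer_iff ℂ).mp h _ (gaugeB_mem_core γ)).1
  · have hle : core X G ≤ StarSubalgebra.centralizer ℂ {a, star a} := by
      refine StarSubalgebra.topologicalClosure_minimal ?_ (isClosed_centralizer _)
      rw [StarAlgebra.adjoin_le_iff]
      have key : ∀ b : QL X G, Commute b a → Commute (star b) a →
          b ∈ StarSubalgebra.centralizer ℂ {a, star a} := by
        intro b h1 h2
        have h3 : Commute b (star a) := by simpa using h2.star_star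
        rw [StarSubalgebra.mem_centralizer_iff]
        rintro c (rfl | rfl)
        · exact ⟨h1.symm, h3.symm⟩
        · rw [star_star]; exact ⟨h3.symm, h1.symm⟩
      rintro _ (⟨t, rfl⟩ | ⟨γ, rfl⟩)
      · exact key _ (h.1 t) (by rw [star_gaugeA]; exact h.1 _)
      · exact key _ (h.2 γ) (by rw [star_gaugeB]; exact h.2 _)
    rw [commutant, StarSubalgebra.mem_centralizer_iff]
    have hb : ∀ b ∈ core X G, b * a = a * b := fun b hb =>
      ((StarSubalgebra.mem_centralizer_iff ℂ).mp (hle hb) a (by simp)).1.symm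
    exact fun b hb' => ⟨hb b hb', hb _ (star_mem hb')⟩

theorem core_le_commutant : core X G ≤ commutant X G := by
  refine StarSubalgebra.topologicalClosure_minimal ?_ isClosed_commutant
  rw [StarAlgebra.adjoin_le_iff]
  rintro _ (⟨t, rfl⟩ | ⟨γ, rfl⟩)
  · exact mem_commutant_iff.mpr
      ⟨fun s => commute_gaugeA_gaugeA s t, fun γ => commute_gaugeB_gaugeA γ t⟩
  · exact mem_commutant_iff.mpr
      ⟨fun t => (commute_gaugeB_gaugeA γ t).symm, fun η => commute_gaugeB_gaugeB η γ⟩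

variable (X G) in
/-- The products `A_t B_γ`. -/
def gaugeMonomials : Set (QL X G) :=
  Set.range fun a : PMap₀ X G (-1) × DualPMap₀ X G 1 => gaugeA a.1 * gaugeB a.2

theorem mul_mem_gaugeMonomials (t : PMap₀ X G (-1)) (γ : DualPMap₀ X G 1) :
    gaugeA t * gaugeB γ ∈ gaugeMonomials X G := ⟨(t, γ), rfl⟩

theorem gaugeA_mem_gaugeMonomials (t : PMap₀ X G (-1)) : gaugeA t ∈ gaugeMonomials X G := by
  rw [← mul_one (gaugeA t), ← gaugeB_zero]; exact mul_mem_gaugeMonomials t 0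

theorem gaugeB_mem_gaugeMonomials (γ : DualPMap₀ X G 1) : gaugeB γ ∈ gaugeMonomials X G := by
  rw [← one_mul (gaugeB γ), ← gaugeA_zero]; exact mul_mem_gaugeMonomials 0 γ

theorem core_subset_closure :
    (core X G : Set (QL X G)) ⊆ closure (Submodule.span ℂ (gaugeMonomials X G)) := by
  refine closure_mono fun a ha =>
    mem_span_of_mem_adjoin (M := gaugeMonomials X G) ?_ ?_ ?_ ?_ ha
  · have h := gaugeA_mem_gaugeMonomials (0 : PMap₀ X G (-1))
    rw [gaugeA_zero] at h
    exact Submodule.subset_span h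
  · rintro _ ⟨⟨s, γ⟩, rfl⟩ _ ⟨⟨t, η⟩, rfl⟩
    refine Submodule.subset_span ?_
    dsimp only
    rw [mul_assoc, ← mul_assoc (gaugeB γ), (commute_gaugeB_gaugeA γ t).eq, mul_assoc,
      ← mul_assoc, ← gaugeA_add, ← gaugeB_add]
    exact mul_mem_gaugeMonomials _ _
  · rintro _ ⟨⟨s, γ⟩, rfl⟩
    refine Submodule.subset_span ?_
    dsimp only
    rw [star_mul, star_gaugeA, star_gaugeB, (commute_gaugeB_gaugeA _ _).eq]
    exact mul_mem_gaugeMonomials _ _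
  · rintro _ (⟨t, rfl⟩ | ⟨γ, rfl⟩)
    · exact Submodule.subset_span (gaugeA_mem_gaugeMonomials t)
    · exact Submodule.subset_span (gaugeB_mem_gaugeMonomials γ)

theorem IsSeed.unique {ϑ ϑ' : State (core X G)} (h : IsSeed ϑ) (h' : IsSeed ϑ') : ϑ = ϑ' := by
  refine State.ext_of_span (A := QL X G) (S := core X G) isClosed_core
    (M := gaugeMonomials X G) ?_ core_subset_closure ?_
  · rintro _ ⟨a, rfl⟩
    exact mul_mem (gaugeA_mem_core _) (gaugeB_mem_core _)
  · rintro _ ⟨⟨t, γ⟩, rfl⟩ _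
    exact (h t γ).trans (h' t γ).symm

/-- The state of a unit vector. -/
def vectorState (ψ : Hilb X G) (h : ‖ψ‖ = 1) : State (QL X G) where
  toLinearMap :=
    { toFun := fun a => inner ℂ ψ (a.1 ψ)
      map_add' := fun a b => inner_add_right _ _ _
      map_smul' := fun c a => inner_smul_right _ _ _ }
  map_one := by
    change inner ℂ ψ ψ = (1 : ℂ)
    rw [inner_self_eq_norm_sq_to_K, h]; simp
  nonneg a := by
    change 0 ≤ inner ℂ ψ ((star a.1) (a.1 ψ))
    rw [ContinuousLinearMap.star_eq_adjoint, ContinuousLinearMap.adjoint_inner_right,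
      inner_self_eq_norm_sq_to_K, ← RCLike.ofReal_pow]
    exact Complex.zero_le_real.mpr (sq_nonneg ‖a.1 ψ‖)

/-- The vector is the normalized sum over the orbit of |0⟩ under the A_t with t supported in Λ. Such
A_t permute the summands, and every B_γ fixes each summand because coboundaries pair trivially. -/
theorem exists_invariant_vector (Λ : Finset (Site X)) : ∃ ψ : Hilb X G, ‖ψ‖ = 1 ∧
    (∀ t ∈ supportedIn (X := X) (fun n => G.grp (n - (-1))) Λ, (gaugeA t).1 ψ = ψ) ∧
    ∀ γ : DualPMap₀ X G 1, (gaugeB γ).1 ψ = ψ := by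
  classical
  have := Fintype.ofFinite (supportedIn (X := X) (fun n => G.grp (n - (-1))) Λ)
  let D : PMap₀ X G (-1) →+ Conf X G := deltaHom X G (by norm_num)
  let φ : Hilb X G := ∑ t : supportedIn (X := X) (fun n => G.grp (n - (-1))) Λ, ket (D t.1)
  -- The coefficient of |0⟩ counts the t with δ⁻¹t = 0, and t = 0 is one of them.
  have hφ : φ ≠ 0 := by
    intro h0
    have h1 : inner ℂ (ket 0) φ = (0 : ℂ) := by rw [h0, inner_zero_right]
    simp only [φ, inner_sum, inner_ket] at h1
    rw [Finset.sum_ite, Finset.sum_const_zero, add_zero, Finset.sum_const, nsmul_one] at h1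
    rw [Nat.cast_eq_zero, Finset.card_eq_zero, Finset.filter_eq_empty_iff] at h1
    exact h1 (Finset.mem_univ 0) (map_zero D).symm
  have hA : ∀ t ∈ supportedIn (X := X) (fun n => G.grp (n - (-1))) Λ, (gaugeA t).1 φ = φ := by
    intro t ht
    change shiftOp (D t) φ = φ
    simp only [φ, map_sum, shiftOp_ket, ← map_add]
    exact Equiv.sum_comp (Equiv.addLeft (⟨t, ht⟩ : supportedIn (X := X) _ Λ))
      (fun s => ket (D s.1))
  have hB : ∀ γ : DualPMap₀ X G 1, (gaugeB γ).1 φ = φ := by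
    intro γ
    change clockOp (dualDeltaHom X G (by norm_num) γ) φ = φ
    simp only [φ, map_sum, clockOp_ket]
    refine Finset.sum_congr rfl fun t _ => ?_
    have h : pairing (dualDeltaHom X G (by norm_num : (0 : ℤ) + 1 = 1) γ).1 (D t.1).1 = 1 :=
      pairing_dualDelta_delta (by norm_num) (by norm_num) γ t.1
    rw [h, Circle.coe_one, one_smul]
  refine ⟨((‖φ‖ : ℂ)⁻¹) • φ, norm_smul_inv_norm hφ, fun t ht => ?_, fun γ => ?_⟩
  · rw [map_smul, hA t ht]
  · rw [map_smul, hB]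

/-- Each t is supported in all large Λ, so the vector states take the required value at A_tB_γ
eventually, and the limit state inherits it. -/
theorem exists_isSeed : ∃ ϑ : State (core X G), IsSeed ϑ := by
  classical
  choose ψ hn hA hB using exists_invariant_vector (X := X) (G := G)
  obtain ⟨ω, hω⟩ := State.exists_limit fun Λ => vectorState (ψ Λ) (hn Λ)
  refine ⟨ω.restrict (core X G), fun t γ => hω _ _ ?_⟩
  obtain ⟨Λ₀, h₀⟩ := exists_mem_supportedIn t
  filter_upwards [Filter.eventually_ge_atTop Λ₀] with Λ hΛ
  change inner ℂ (ψ Λ) ((gaugeA t).1 ((gaugeB γ).1 (ψ Λ))) = (1 : ℂ)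
  rw [hB, hA Λ t (supportedIn_mono hΛ h₀), inner_self_eq_norm_sq_to_K, hn]
  simp

end Core

/-! ### Gauge-invariant states and frustration-freeness -/

section GaugeInvariant

/-- The states taking the value `1` at all `A_t` and `B_γ`. -/
def IsGaugeInvariant (ω : State (QL X G)) : Prop :=
  (∀ t, ω (gaugeA t) = 1) ∧ ∀ γ, ω (gaugeB γ) = 1

theorem gaugeA_mem_unitary (t : PMap₀ X G (-1)) : gaugeA t ∈ unitary (QL X G) :=
  shift_mem_unitary _

theorem gaugeB_mem_unitary (γ : DualPMap₀ X G 1) : gaugeB γ ∈ unitary (QL X G) :=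
  clock_mem_unitary _

namespace IsGaugeInvariant

variable {ω ω' : State (QL X G)}

theorem isSeed (h : IsGaugeInvariant ω) : IsSeed (ω.restrict (core X G)) := fun t γ =>
  (ω.map_unitary_mul (gaugeA_mem_unitary t) (h.1 t) (gaugeB γ)).trans (h.2 γ)

theorem restrict_mem_statesOver (h : IsGaugeInvariant ω) {ϑ : State (core X G)} (hϑ : IsSeed ϑ) :
    ω.restrict (commutant X G) ∈ statesOver ϑ := fun a ha _ => by
  rw [hϑ.unique h.isSeed]; rfl

theorem of_restrict_mem {ϑ : State (core X G)} (hϑ : IsSeed ϑ)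
    (h : ω.restrict (commutant X G) ∈ statesOver ϑ) : IsGaugeInvariant ω := by
  have key : ∀ t γ, ω (gaugeA t * gaugeB γ) = 1 := fun t γ => by
    have hm := mul_mem (gaugeA_mem_core t) (gaugeB_mem_core γ)
    exact (h _ hm (core_le_commutant hm)).trans (hϑ t γ)
  refine ⟨fun t => ?_, fun γ => ?_⟩
  · simpa [gaugeB_zero] using key t 0
  · simpa [gaugeA_zero] using key 0 γ

/-- Some A_s or B_η commutes with the monomial only up to a phase c ≠ 1, and invariance turns this
into (c - 1)ω(P_tQ_γ) = 0. -/
theorem map_weyl_eq_zero (h : IsGaugeInvariant ω) {t : Conf X G} {γ : Repr X G}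
    (hn : shift t * clock γ ∉ commutant X G) : ω (shift t * clock γ) = 0 := by
  rw [mem_commutant_iff, not_and_or, not_forall, not_forall] at hn
  rcases hn with ⟨s, hs⟩ | ⟨η, hη⟩
  · have e := weyl_mul_gaugeA t γ s
    set c := (pairing (dualDelta X G (by norm_num : (-1 : ℤ) + 1 = 0) γ.1) s.1 : ℂ) with hc
    have hc1 : c ≠ 1 := fun h1 => hs (by rw [h1, one_smul] at e; exact e.symm)
    have h1 := ω.map_mul_unitary (gaugeA_mem_unitary s) (h.1 s) (shift t * clock γ)
    rw [e, map_smul, ω.map_unitary_mul (gaugeA_mem_unitary s) (h.1 s), smul_eq_mul] at h1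
    exact (mul_eq_zero.mp (by linear_combination h1 :
      (c - 1) * ω (shift t * clock γ) = 0)).resolve_left (sub_ne_zero.mpr hc1)
  · have e := gaugeB_mul_weyl η t γ
    refine ω.map_eq_zero_of_unitary (gaugeB_mem_unitary η) (h.2 η) (fun h1 => hη ?_) e
    rw [h1, one_smul] at e
    exact e

theorem ext_of_restrict (h : IsGaugeInvariant ω) (h' : IsGaugeInvariant ω')
    (he : ω.restrict (commutant X G) = ω'.restrict (commutant X G)) : ω = ω' := by
  refine State.ext_of_weyl fun t γ => ?_
  by_cases hm : shift t * clock γ ∈ commutant X G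
  · exact congrArg (fun τ : State (commutant X G) => τ ⟨_, hm⟩) he
  · rw [h.map_weyl_eq_zero hm, h'.map_weyl_eq_zero hm]

end IsGaugeInvariant

/-- The definition normalizes by the order of 𝔾_{n-1} but sums over its dual; a finite abelian group
and its dual have equal order. -/
theorem plaquetteOp_eq_average (x : Site X) :
    plaquetteOp G x = average fun α : G.dual (x.1 - 1) => gaugeB (dualLocalized X G x α) := by
  classical
  have h : Nat.card (G.grp (x.1 - 1)) = Nat.card (G.dual (x.1 - 1)) := by
    have := Fintype.ofFinite (G.grp (x.1 - 1))
    rw [Nat.card_congr (AddChar.circleEquivComplex (α := G.grp (x.1 - 1))).toEquiv,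
      Nat.card_eq_fintype_card, Nat.card_eq_fintype_card, AddChar.card_eq]
  rw [plaquetteOp, average, h]

theorem gaugeA_localized_add (x : Site X) (g h : G.grp (x.1 - (-1))) :
    gaugeA (localized X G x (g + h)) = gaugeA (localized X G x g) * gaugeA (localized X G x h) := by
  rw [localized_add, gaugeA_add]

theorem gaugeB_dualLocalized_add (x : Site X) (α β : G.dual (x.1 - 1)) :
    gaugeB (dualLocalized X G x (α + β)) =
      gaugeB (dualLocalized X G x α) * gaugeB (dualLocalized X G x β) := by
  rw [dualLocalized_add, gaugeB_add]

theorem localized_neg {p : ℤ} (x : Site X) (g : G.grp (x.1 - p)) :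
    localized X G x (-g) = -localized X G x g :=
  map_neg (AddMonoidHom.mk' (localized X G x) (localized_add x)) g

theorem dualLocalized_neg {p : ℤ} (x : Site X) (α : G.dual (x.1 - p)) :
    dualLocalized X G x (-α) = -dualLocalized X G x α :=
  map_neg (AddMonoidHom.mk' (dualLocalized X G x) (dualLocalized_add x)) α

theorem star_starOp (x : Site X) : star (starOp G x) = starOp G x :=
  star_average fun g => by rw [star_gaugeA, localized_neg]

theorem starOp_mul_self (x : Site X) : starOp G x * starOp G x = starOp G x :=
  average_mul_self (gaugeA_localized_add x)

theorem star_plaquetteOp (x : Site X) : star (plaquetteOp G x) = plaquetteOp G x := by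
  rw [plaquetteOp_eq_average]
  exact star_average fun α => by rw [star_gaugeB, dualLocalized_neg]

theorem plaquetteOp_mul_self (x : Site X) :
    plaquetteOp G x * plaquetteOp G x = plaquetteOp G x := by
  rw [plaquetteOp_eq_average]
  exact average_mul_self (gaugeB_dualLocalized_add x)

theorem norm_map_unitary_le (ω : State (QL X G)) {u : QL X G} (hu : u ∈ unitary (QL X G)) :
    ‖ω u‖ ≤ 1 := by
  have : Nontrivial (QL X G) := nontrivial_of_ne 1 0 fun h => by simpa [h] using ω.map_one
  exact (ω.norm_map_le u).trans (CStarRing.norm_of_mem_unitary hu).le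

/-- Expectation 1 of the averages gives it for the one-simplex A_t and B_γ; invariance under
unitaries of expectation 1 passes it on to products. -/
theorem isGaugeInvariant_of_mem_FG {ω : State (QL X G)} (h : ω ∈ FG X G) : IsGaugeInvariant ω := by
  obtain ⟨-, hA, hB⟩ := h
  refine ⟨fun t => ?_, fun γ => ?_⟩
  · induction t using compactlySupported_induction with
    | zero => rw [gaugeA_zero, ω.map_one]
    | add s t hs ht =>
      rw [gaugeA_add, ω.map_unitary_mul (gaugeA_mem_unitary s) hs, ht]
    | single x t ht =>
      rw [eq_localized ht]
      exact ω.map_eq_one_of_average (U := fun g => gaugeA (localized X G x g))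
        (fun g => norm_map_unitary_le ω (gaugeA_mem_unitary _)) (hA x) _
  · induction γ using compactlySupported_induction with
    | zero => rw [gaugeB_zero, ω.map_one]
    | add γ η hγ hη =>
      rw [gaugeB_add, ω.map_unitary_mul (gaugeB_mem_unitary γ) hγ, hη]
    | single x γ hγ =>
      rw [eq_dualLocalized hγ]
      have hx := hB x
      rw [plaquetteOp_eq_average] at hx
      exact ω.map_eq_one_of_average (U := fun α => gaugeB (dualLocalized X G x α))
        (fun α => norm_map_unitary_le ω (gaugeB_mem_unitary _)) hx _

theorem IsGaugeInvariant.map_starOp {ω : State (QL X G)} (h : IsGaugeInvariant ω) (x : Site X) :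
    ω (starOp G x) = 1 := ω.map_average fun _ => h.1 _

theorem IsGaugeInvariant.map_plaquetteOp {ω : State (QL X G)} (h : IsGaugeInvariant ω)
    (x : Site X) : ω (plaquetteOp G x) = 1 := by
  rw [plaquetteOp_eq_average]
  exact ω.map_average fun _ => h.2 _

end GaugeInvariant

/-! ### The derivation and the ground state condition -/

section Dynamics

/-- A local observable is a finite combination of Weyl monomials, and finiteness of the exceptional
set survives sums and scalar multiples. -/
theorem finite_not_commute {K : Site X → QL X G}
    (h : ∀ t γ, {x | ¬ Commute (K x) (shift t * clock γ)}.Finite) {a : QL X G}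
    (ha : a ∈ localObservables X G) : {x | ¬ Commute (K x) a}.Finite := by
  obtain ⟨Λ, hΛ⟩ := ha
  have key : ∀ T ∈ Submodule.span ℂ (weylMonomials X G),
      {x | ¬ Commute (K x).1 T}.Finite := by
    intro T hT
    induction hT using Submodule.span_induction with
    | mem T hT =>
      obtain ⟨⟨t, γ⟩, rfl⟩ := hT
      exact (h t γ).subset fun x hx hc => hx (congrArg Subtype.val hc)
    | zero => simp
    | add S T _ _ hS hT =>
      refine (hS.union hT).subset fun x hx => ?_
      by_contra hc
      simp only [Set.mem_union, Set.mem_ofPred_eq, not_or, not_not] at hc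
      exact hx (hc.1.add_right hc.2)
    | smul c T _ hT => exact hT.subset fun x hx hc => hx (hc.smul_right c)
  exact (key a.1 hΛ.mem_span).subset fun x hx hc => hx (Subtype.ext hc)

theorem finite_not_commute_starOp {a : QL X G} (ha : a ∈ localObservables X G) :
    {x | ¬ Commute (starOp G x) a}.Finite := by
  refine finite_not_commute (fun t γ => ?_) ha
  refine (dualDelta_mem X G (by norm_num : (-1 : ℤ) + 1 = 0) γ.1 γ.2).subset fun x hx hx0 => ?_
  refine hx (commute_average fun g => ?_)
  have hv : val (dualDelta X G (by norm_num : (-1 : ℤ) + 1 = 0) γ.1) x = 0 := hx0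
  have e := weyl_mul_gaugeA t γ (localized X G x g)
  rw [pairing_eq_of_right (fun y hy => val_localized_of_ne hy g), hv, AddChar.zero_apply,
    Circle.coe_one, one_smul] at e
  exact e.symm

theorem finite_not_commute_plaquetteOp {a : QL X G} (ha : a ∈ localObservables X G) :
    {x | ¬ Commute (plaquetteOp G x) a}.Finite := by
  refine finite_not_commute (fun t γ => ?_) ha
  refine (delta_mem X G (by norm_num : (0 : ℤ) + 1 = 1) t.1 t.2).subset fun x hx hx0 => ?_
  refine hx ?_
  rw [plaquetteOp_eq_average]
  refine commute_average fun α => ?_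
  have hv : val (delta X G (by norm_num : (0 : ℤ) + 1 = 1) t.1) x = 0 := hx0
  have e := gaugeB_mul_weyl (dualLocalized X G x α) t γ
  rw [pairing_eq_of_left (fun y hy => val_dualLocalized_of_ne hy α), hv, AddChar.map_zero_eq_one,
    Circle.coe_one, one_smul] at e
  exact e

open Classical in
-- Once Λ₀ contains the supports of all terms that fail to commute with a, enlarging it adds only
-- commuting terms.
theorem commute_sum_sub_sum {A : Type*} [Ring A] {K : Site X → A} {S : Site X → Set (Site X)}
    (hS : ∀ x, x ∈ S x) {a : A} {Λ₀ Λ : Finset (Site X)} (hΛ : Λ₀ ⊆ Λ)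
    (h : ∀ x, ¬ Commute (K x) a → S x ⊆ (Λ₀ : Set (Site X))) :
    Commute ((∑ x ∈ Λ with S x ⊆ (Λ : Set (Site X)), K x) -
      ∑ x ∈ Λ₀ with S x ⊆ (Λ₀ : Set (Site X)), K x) a := by
  have hsub : Λ₀.filter (fun x => S x ⊆ (Λ₀ : Set (Site X))) ⊆
      Λ.filter (fun x => S x ⊆ (Λ : Set (Site X))) := by
    intro x hx
    rw [Finset.mem_filter] at hx ⊢
    exact ⟨hΛ hx.1, hx.2.trans (by exact_mod_cast hΛ)⟩
  rw [← Finset.sum_sdiff hsub, add_sub_cancel_right]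
  refine Commute.sum_left _ _ _ fun x hx => ?_
  by_contra hc
  have := h x hc
  exact (Finset.mem_sdiff.mp hx).2 (Finset.mem_filter.mpr ⟨by exact_mod_cast this (hS x), this⟩)

theorem exists_derivation_eq {a : QL X G} (ha : a ∈ localObservables X G) :
    ∃ Λ : Finset (Site X), derivation X G a =
      Complex.I • (hamiltonian X G Λ * a - a * hamiltonian X G Λ) := by
  classical
  have hfin : ((⋃ x ∈ {x | ¬ Commute (starOp G x) a}, starSupp x) ∪
      ⋃ x ∈ {x | ¬ Commute (plaquetteOp G x) a}, plaquetteSupp x).Finite :=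
    ((finite_not_commute_starOp ha).biUnion fun x _ =>
      (Set.finite_singleton x).union (finite_cofaces X x)).union
    ((finite_not_commute_plaquetteOp ha).biUnion fun x _ =>
      (Set.finite_singleton x).union (finite_faces X x))
  refine ⟨hfin.toFinset, ?_⟩
  -- `limUnder` is meaningful only for a convergent net; here the commutators are constant beyond
  -- the union of the supports of the noncommuting terms.
  refine Filter.Tendsto.limUnder_eq (tendsto_const_nhds.congr' ?_)
  filter_upwards [Filter.eventually_ge_atTop hfin.toFinset] with Λ hΛ
  have h1 := commute_sum_sub_sum (K := starOp G) (S := starSupp) (a := a)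
    (fun x => Or.inl rfl) hΛ fun x hx => by
      rw [Set.Finite.coe_toFinset]
      exact (Set.subset_biUnion_of_mem (u := starSupp) hx).trans Set.subset_union_left
  have h2 := commute_sum_sub_sum (K := plaquetteOp G) (S := plaquetteSupp) (a := a)
    (fun x => Or.inl rfl) hΛ fun x hx => by
      rw [Set.Finite.coe_toFinset]
      exact (Set.subset_biUnion_of_mem (u := plaquetteSupp) hx).trans Set.subset_union_right
  have h3 : Commute (hamiltonian X G hfin.toFinset - hamiltonian X G Λ) a := by
    convert h1.add_left h2 using 1
    rw [hamiltonian, hamiltonian]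
    abel
  congr 1
  have h4 := h3.eq
  rw [sub_mul, mul_sub, sub_eq_sub_iff_sub_eq_sub] at h4
  exact h4

/-- The factors -i and i cancel, leaving ω(a*[H^Λ, a]) for one finite Λ, where each term of the
Hamiltonian contributes nonnegatively. -/
theorem IsGaugeInvariant.mem_FG {ω : State (QL X G)} (h : IsGaugeInvariant ω) : ω ∈ FG X G := by
  classical
  refine ⟨fun a ha => ?_, h.map_starOp, h.map_plaquetteOp⟩
  obtain ⟨Λ, hΛ⟩ := exists_derivation_eq ha
  rw [hΛ, mul_smul_comm, map_smul, smul_eq_mul, ← mul_assoc, neg_mul, Complex.I_mul_I, neg_neg,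
    one_mul]
  exact ω.nonneg_commutator_sum _ _ star_starOp starOp_mul_self h.map_starOp star_plaquetteOp
    plaquetteOp_mul_self h.map_plaquetteOp a

end Dynamics

end

end HAQDM

end

/-! ### The main theorem -/

theorem mainTheorem3 {V : Type*} [LinearOrder V] {N L : ℕ}
    (X : HAQDM.GeometricData V N L) (G : HAQDM.AlgebraicData N) :
    HAQDM.core X G ≤ HAQDM.commutant X G ∧
    (∃! ϑ : HAQDM.State (HAQDM.core X G), HAQDM.IsSeed ϑ) ∧
    ∀ ϑ : HAQDM.State (HAQDM.core X G), HAQDM.IsSeed ϑ →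
      Set.BijOn (HAQDM.State.restrict (HAQDM.commutant X G))
        (HAQDM.FG X G) (HAQDM.statesOver ϑ) ∧
      ∀ τ ∈ HAQDM.statesOver ϑ, ∃ ω ∈ HAQDM.FG X G,
        (∀ ω' : HAQDM.State (HAQDM.QL X G),
          ω'.restrict (HAQDM.commutant X G) = τ ↔ ω' = ω) ∧
        ∀ (t : HAQDM.Conf X G) (γ : HAQDM.Repr X G),
          (∀ h : HAQDM.shift t * HAQDM.clock γ ∈ HAQDM.commutant X G,
            ω (HAQDM.shift t * HAQDM.clock γ) = τ ⟨HAQDM.shift t * HAQDM.clock γ, h⟩) ∧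
          (HAQDM.shift t * HAQDM.clock γ ∉ HAQDM.commutant X G →
            ω (HAQDM.shift t * HAQDM.clock γ) = 0) := by
  refine ⟨HAQDM.core_le_commutant, ?_, fun ϑ hϑ => ?_⟩
  · obtain ⟨ϑ, hϑ⟩ := HAQDM.exists_isSeed (X := X) (G := G)
    exact ⟨ϑ, hϑ, fun ϑ' h' => h'.unique hϑ⟩
  have hext : ∀ τ ∈ HAQDM.statesOver ϑ, ∃ ω : HAQDM.State (HAQDM.QL X G),
      HAQDM.IsGaugeInvariant ω ∧ ω.restrict (HAQDM.commutant X G) = τ := by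
    intro τ hτ
    refine (HAQDM.State.exists_extension (A := HAQDM.QL X G)
      (HAQDM.commutant X G) HAQDM.isClosed_commutant τ).imp fun ω hω => ⟨?_, hω⟩
    -- Any extension of τ is gauge invariant, since 𝔎 ⊆ 𝔎' and τ restricts to the seed state there;
    -- uniqueness below uses the same fact.
    exact HAQDM.IsGaugeInvariant.of_restrict_mem hϑ (hω ▸ hτ)
  refine ⟨⟨fun ω hω => ?_, fun ω hω ω' hω' he => ?_, fun τ hτ => ?_⟩, fun τ hτ => ?_⟩
  · exact (HAQDM.isGaugeInvariant_of_mem_FG hω).restrict_mem_statesOver hϑ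
  · exact (HAQDM.isGaugeInvariant_of_mem_FG hω).ext_of_restrict
      (HAQDM.isGaugeInvariant_of_mem_FG hω') he
  · obtain ⟨ω, hω, he⟩ := hext τ hτ
    exact ⟨ω, hω.mem_FG, he⟩
  · obtain ⟨ω, hω, rfl⟩ := hext τ hτ
    refine ⟨ω, hω.mem_FG, fun ω' => ⟨fun h => ?_, fun h => by rw [h]⟩, fun t γ =>
      ⟨fun _ => rfl, hω.map_weyl_eq_zero⟩⟩
    exact (HAQDM.IsGaugeInvariant.of_restrict_mem hϑ (by rwa [h])).ext_of_restrict hω h
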